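/- Let $m=(m_0,m_1,\dots)$ be a bounded sequence of integers $m_k\ge 2$, and let $G_m=\prod_{k\ge 0}\mathbb Z/m_k\mathbb Z$ be the associated (bounded) Vilenkin group, with the normalized Haar measure $\mu$, i.e. the product of the uniform probability measures on the factors. Identify $x_k\in\mathbb Z/m_k\mathbb Z$ with its representative in $\{0,\dots,m_k-1\}$. For $x\in G_m$ and $n\ge 0$ let $I_n(x)=\{y\in G_m: y_k=x_k \text{ for all } k<n\}$ and let $\mathcal F_n$ be the $\sigma$-algebra generated by the sets $I_n(x)$, $x\in G_m$. Put $M_0=1$, $M_{k+1}=m_kM_k$, write each integer $n\ge 0$ as $n=\sum_k n_kM_k$ with $0\le n_k<m_k$, and let $\psi_n(x)=\prod_k \exp(2\pi i x_k/m_k)^{n_k}$ be the Vilenkin functions. For a complex-valued martingale $f=(f^{(n)})_{n\ge0}$ with respect to $(\mathcal F_n)_{n\ge 0}$ put $f^*=\sup_{n\ge0}|f^{(n)}|$ and, for $0<p<\infty$, $\|f\|_{H_p}=\|f^*\|_p$, where $\|g\|_p=\left(\int_{G_m}|g|^p\,d\mu\right)^{1/p}$; the Hardy space $H_p(G_m)$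 consists of the martingales with $\|f\|_{H_p}<\infty$. Let $$\widehat f(i)=\lim_{k\to\infty}\int_{G_m} f^{(k)}\,\overline{\psi_i}\,d\mu,\qquad S_nf=\sum_{k=0}^{n-1}\widehat f(k)\psi_k,\qquad R_nf=\frac1{l_n}\sum_{k=1}^n\frac{S_kf}{k},\qquad l_n=\sum_{k=1}^n\frac1k,$$ and let $R^*f=\sup_{n\ge1}|R_nf|$ be the maximal operator of the Riesz logarithmic means. Theorem. For every real $p>1/2$ the operator $R^*$ is bounded from $H_p(G_m)$ to $L_p(G_m)$: there is a constant $C<\infty$, depending only on $m$ and $p$, such that $\|R^*f\|_p\le C\,\|f\|_{H_p}$ for every $f\in H_p(G_m)$. -/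

import Mathlib

open MeasureTheory Filter Topology
open scoped ENNReal NNReal ComplexConjugate

noncomputable section

namespace Vilenkin

/-- The Vilenkin group `G_m`: the complete direct product of the cyclic groups `ℤ / m_k`. -/
abbrev VilenkinGroup (m : ℕ → ℕ) : Type := ∀ k : ℕ, ZMod (m k)

variable (m : ℕ → ℕ)

/-- The measure on `ℤ / m_k` that gives mass `1 / m_k` to every point. -/
def factorMeasure (k : ℕ) : Measure (ZMod (m k)) :=
  (m k : ℝ≥0∞)⁻¹ • Measure.count

/-- Each factor measure is a probability measure, so that the product measure below is the
genuine product. -/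
theorem isProbabilityMeasure_factorMeasure (hm : ∀ k, 2 ≤ m k) (k : ℕ) :
    IsProbabilityMeasure (factorMeasure m k) := by
  have h0 : m k ≠ 0 := by have := hm k; omega
  have : NeZero (m k) := ⟨h0⟩
  constructor
  rw [factorMeasure, Measure.smul_apply, Measure.count_apply_finite Set.univ Set.finite_univ]
  simp only [Set.Finite.toFinset_univ, Finset.card_univ, ZMod.card, smul_eq_mul]
  exact ENNReal.inv_mul_cancel (by exact_mod_cast h0) (ENNReal.natCast_ne_top _)

/-- The normalized Haar measure on `G_m`: the product of the uniform measures. -/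
def haar : Measure (VilenkinGroup m) := Measure.infinitePi (factorMeasure m)

/-- The interval `I_n(x)`: all points that agree with `x` in the first `n` coordinates. -/
def interval (n : ℕ) (x : VilenkinGroup m) : Set (VilenkinGroup m) :=
  {y | ∀ k < n, y k = x k}

/-- The `σ`-algebra `F_n` generated by the intervals `I_n(x)`, `x ∈ G_m`. -/
@[reducible]
def intervalAlgebra (n : ℕ) : MeasurableSpace (VilenkinGroup m) :=
  MeasurableSpace.generateFrom (Set.range (interval m n))

theorem intervalAlgebra_mono : Monotone (intervalAlgebra m) := by
  refine monotone_nat_of_le_succ fun n => MeasurableSpace.generateFrom_le ?_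
  rintro _ ⟨x, rfl⟩
  have h : interval m n x = ⋃ a : ZMod (m n), interval m (n + 1) (Function.update x n a) := by
    ext y
    simp only [interval, Set.mem_ofPred_eq, Set.mem_iUnion]
    constructor
    · intro hy
      refine ⟨y n, fun k hk => ?_⟩
      rcases Nat.lt_succ_iff_lt_or_eq.mp hk with h | rfl
      · rw [Function.update_of_ne h.ne, hy k h]
      · simp
    · rintro ⟨a, ha⟩ k hk
      rw [ha k (by omega), Function.update_of_ne hk.ne]
  have hc : Countable (ZMod (m n)) := by
    cases m n with
    | zero => exact inferInstanceAs (Countable ℤ)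
    | succ k => exact inferInstanceAs (Countable (Fin (k + 1)))
  rw [h]
  exact MeasurableSet.iUnion fun a => MeasurableSpace.measurableSet_generateFrom ⟨_, rfl⟩

theorem intervalAlgebra_le (n : ℕ) : intervalAlgebra m n ≤ MeasurableSpace.pi := by
  refine MeasurableSpace.generateFrom_le ?_
  rintro _ ⟨x, rfl⟩
  have h : interval m n x = ⋂ k : ℕ, ⋂ _ : k < n, (fun y : VilenkinGroup m => y k) ⁻¹' {x k} := by
    ext y
    simp [interval]
  rw [h]
  exact MeasurableSet.iInter fun k => MeasurableSet.iInter fun _ =>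
    measurable_pi_apply k (MeasurableSpace.measurableSet_top)

/-- The filtration `(F_n)`. -/
def filtration : Filtration ℕ (MeasurableSpace.pi : MeasurableSpace (VilenkinGroup m)) where
  seq := intervalAlgebra m
  mono' := intervalAlgebra_mono m
  le' := intervalAlgebra_le m

/-- The generalized powers: `M_0 = 1`, `M_{k+1} = m_k M_k`. -/
def genPow : ℕ → ℕ
  | 0 => 1
  | k + 1 => m k * genPow k

/-- The digit `n_k ∈ {0, …, m_k - 1}` in the expansion `n = ∑ n_k M_k`. -/
def digit (n k : ℕ) : ℕ := n / genPow m k % m k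

/-- The generalized Rademacher function `r_k(x) = exp (2 π i x_k / m_k)`. -/
def rademacher (k : ℕ) (x : VilenkinGroup m) : ℂ :=
  Complex.exp (2 * Real.pi * Complex.I * ((x k).val : ℂ) / (m k : ℂ))

/-- The Vilenkin function `ψ_n = ∏_k r_k ^ n_k`. As all `m_k` are at least `2`, one has
`n < 2 ^ n ≤ M_n`, so that the digits `n_k` with `k ≥ n` vanish. -/
def psi (n : ℕ) (x : VilenkinGroup m) : ℂ :=
  ∏ k ∈ Finset.range n, rademacher m k x ^ digit m n k

/-- The Vilenkin-Fourier coefficients of a martingale `f = (f^{(k)})`: the limit of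
`∫ f^{(k)} conj ψ_i dμ` (for a martingale this sequence is eventually constant). -/
def vilenkinCoeff (f : ℕ → VilenkinGroup m → ℂ) (i : ℕ) : ℂ :=
  limUnder atTop fun k : ℕ => ∫ x, f k x * conj (psi m i x) ∂(haar m)

/-- The partial sums of the Vilenkin-Fourier series: `S_n f` is the sum over `k < n` of the `k`-th
Vilenkin-Fourier coefficient of `f` times `ψ_k`. -/
def partialSum (f : ℕ → VilenkinGroup m → ℂ) (n : ℕ) (x : VilenkinGroup m) : ℂ :=
  ∑ k ∈ Finset.range n, vilenkinCoeff m f k * psi m k x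

/-- `l_n = ∑_{k=1}^n 1/k`. -/
def logWeight (n : ℕ) : ℝ := ∑ k ∈ Finset.Icc 1 n, 1 / (k : ℝ)

/-- The Riesz logarithmic means `R_n f = (1 / l_n) ∑_{k=1}^n S_k f / k` (with `R_0 f = 0`). -/
def rieszMean (f : ℕ → VilenkinGroup m → ℂ) (n : ℕ) (x : VilenkinGroup m) : ℂ :=
  1 / (logWeight n : ℂ) * ∑ k ∈ Finset.Icc 1 n, partialSum m f k x / (k : ℂ)

/-- The maximal operator `R^* f = sup_n |R_n f|`, with values in `[0, ∞]`. -/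
def rieszMaximal (f : ℕ → VilenkinGroup m → ℂ) (x : VilenkinGroup m) : ℝ≥0∞ :=
  ⨆ n : ℕ, ‖rieszMean m f n x‖ₑ

/-- The maximal function `f^* = sup_n |f^{(n)}|` of a martingale, with values in `[0, ∞]`. -/
def maximalFunction (f : ℕ → VilenkinGroup m → ℂ) (x : VilenkinGroup m) : ℝ≥0∞ :=
  ⨆ n : ℕ, ‖f n x‖ₑ

/-- The `L_p` (quasi)norm, `0 < p < ∞`, of a function with values in `[0, ∞]`. -/
def normLp (p : ℝ) (g : VilenkinGroup m → ℝ≥0∞) : ℝ≥0∞ :=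
  (∫⁻ x, g x ^ p ∂(haar m)) ^ (1 / p)

/-- The Hardy space (quasi)norm `‖f‖_{H_p} = ‖f^*‖_p`. -/
def normHp (p : ℝ) (f : ℕ → VilenkinGroup m → ℂ) : ℝ≥0∞ :=
  normLp m p (maximalFunction m f)

/-- The martingale Hardy space `H_p(G_m)`: martingales with respect to `(F_n)` for which
`‖f‖_{H_p} < ∞`. -/
def MemHp (p : ℝ) (f : ℕ → VilenkinGroup m → ℂ) : Prop :=
  Martingale f (filtration m) (haar m) ∧ normHp m p f < ∞

end Vilenkin

end

/-!
Summation by parts writes the Riesz mean `R_n f` as a convex combination of the Fejér means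
`σ_k f = (1 / k) ∑_{j=1}^k S_j f`, `k ≤ n` (`norm_rieszMean_le`), so it is enough to bound
`sup_k |σ_k f|`. The argument needs no atomic decomposition and no interpolation, and treats all
`p > 1 / 2` at once.

*The kernel.* Splitting off digits gives a pointwise bound of the Fejér kernels: for
`n < M_{N+1}`, `n |K_n|` is at most a constant times `∑_{s ≤ A ≤ N} M_A M_s 1_{J(A, s)}`, where
`J(A, s)` is the set of points whose first `A` coordinates other than `s` vanish
(`norm_fejerSum_le`). As `S_k f = S_k f^{(N+1)}` for `k ≤ M_{N+1}`, the Fejér sums of `f` are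
controlled by the sums of `M_s E_A|f^{(N+1)}|(x + j e_s)` over `s ≤ A ≤ N` and `j`, where `E_A` is
the conditional expectation on `F_A` (`enorm_sum_partialSum_le`).

*From `L_1` to `L_q`.* Fix `1 / 2 < q < min p 1` and put `h = (f^*)^q`. A value of the
`F_{N+1}`-measurable function `|f^{(N+1)}|` is controlled by a local `L_q`-mean, whence
`E_A|f^{(N+1)}| ≤ (M_{N+1} / M_A)^{1/q-1} (E_A h)^{1/q}` (`avg_le_rpow_avg_rpow`). Because `q > 1 / 2`,
the loss is smaller than the factor `M_A / M_N` that is available for large `n`, the sum over `A`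
is geometric, and with `G_A = (max_{a ≤ A} E_a h)^{1/q}` one obtains
`R^* f ≤ C sup_{s ≤ A, j} (M_s / M_A)^{1/2} G_A(x + j e_s)` (`rieszMaximal_le_shiftMax`).

*The translations.* A translation in the coordinate `s` does not change functions of the first `s`
coordinates. Writing `G_A^p` as `G_s^p` plus the increments `G_{a+1}^p - G_a^p`, `s ≤ a < A`, and
using that translations preserve the measure and that `∑_{s ≤ a} (M_s / M_a)^{p/2}` is bounded, one
bounds the `L_p`-norm of this maximal function by that of `sup_A G_A`
(`lintegral_shiftMax_rpow_le`). Doob's inequality in `L_{p/q}`, `p / q > 1`, for the conditional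
expectations of `h` (`exists_lintegral_iSup_maxAvg_rpow_le`) finishes the proof.
-/

noncomputable section

namespace Vilenkin

/-! ### Haar measure, intervals and conditional expectations -/

section

variable {m : ℕ → ℕ}

theorem genPow_pos (hm : ∀ k, 2 ≤ m k) (A : ℕ) : 0 < genPow m A := by
  induction A with
  | zero => simp [genPow]
  | succ k ih => have := hm k; simp only [genPow]; positivity

theorem two_mul_genPow_le (hm : ∀ k, 2 ≤ m k) (A : ℕ) : 2 * genPow m A ≤ genPow m (A + 1) :=
  Nat.mul_le_mul_right _ (hm A)

theorem genPow_mono (hm : ∀ k, 2 ≤ m k) : Monotone (genPow m) :=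
  monotone_nat_of_le_succ fun A => by have := two_mul_genPow_le hm A; omega

theorem lt_genPow (hm : ∀ k, 2 ≤ m k) (n : ℕ) : n < genPow m n := by
  induction n with
  | zero => simp [genPow]
  | succ k ih => have := two_mul_genPow_le hm k; omega

theorem genPow_dvd {A B : ℕ} (h : A ≤ B) : genPow m A ∣ genPow m B := by
  induction B, h using Nat.le_induction with
  | base => rfl
  | succ k _ ih => exact ih.mul_left _

/-- Every `n ≥ 1` lies in a block `M_N ≤ n < M_{N + 1}`. -/
theorem exists_genPow_le_lt (hm : ∀ k, 2 ≤ m k) {n : ℕ} (hn : 1 ≤ n) :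
    ∃ N, genPow m N ≤ n ∧ n < genPow m (N + 1) := by
  classical
  have hex : ∃ N, n < genPow m N := ⟨n, lt_genPow hm n⟩
  have hne : Nat.find hex ≠ 0 := by
    intro h
    have := Nat.find_spec hex
    rw [h] at this
    simp only [genPow] at this
    omega
  obtain ⟨N, hN⟩ := Nat.exists_eq_succ_of_ne_zero hne
  refine ⟨N, not_lt.mp (Nat.find_min hex (by omega)), ?_⟩
  have := Nat.find_spec hex
  rwa [hN] at this

theorem factorMeasure_singleton (k : ℕ) (a : ZMod (m k)) :
    factorMeasure m k {a} = (m k : ℝ≥0∞)⁻¹ := by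
  simp [factorMeasure]

theorem mem_interval_comm {A : ℕ} {x y : VilenkinGroup m} :
    y ∈ interval m A x ↔ x ∈ interval m A y :=
  ⟨fun h k hk => (h k hk).symm, fun h k hk => (h k hk).symm⟩

theorem interval_eq_of_mem {A : ℕ} {x y : VilenkinGroup m} (h : y ∈ interval m A x) :
    interval m A y = interval m A x := by
  ext z
  exact ⟨fun hz k hk => (hz k hk).trans (h k hk), fun hz k hk => (hz k hk).trans (h k hk).symm⟩

theorem interval_anti {A B : ℕ} (h : A ≤ B) (x : VilenkinGroup m) :
    interval m B x ⊆ interval m A x := fun _ hy k hk => hy k (hk.trans_le h)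

theorem measurableSet_interval (A : ℕ) (x : VilenkinGroup m) :
    MeasurableSet (interval m A x) :=
  intervalAlgebra_le m A _ (MeasurableSpace.measurableSet_generateFrom ⟨x, rfl⟩)

/-- The conditional expectation on `F_A` of a `[0, ∞]`-valued function: its mean over the interval
`I_A(x)`, which has measure `1 / M_A`. -/
def avg (A : ℕ) (g : VilenkinGroup m → ℝ≥0∞) (x : VilenkinGroup m) : ℝ≥0∞ :=
  genPow m A * ∫⁻ y in interval m A x, g y ∂haar m

theorem avg_eq_of_mem {A : ℕ} (g : VilenkinGroup m → ℝ≥0∞) {x y : VilenkinGroup m}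
    (h : y ∈ interval m A x) : avg A g y = avg A g x := by
  rw [avg, avg, interval_eq_of_mem h]

theorem avg_mono (A : ℕ) {g h : VilenkinGroup m → ℝ≥0∞} (hgh : ∀ y, g y ≤ h y)
    (x : VilenkinGroup m) : avg A g x ≤ avg A h x := by
  unfold avg; gcongr; exact hgh _

theorem avg_lt_top {A : ℕ} {g : VilenkinGroup m → ℝ≥0∞} (hg : ∫⁻ y, g y ∂haar m ≠ ∞)
    (x : VilenkinGroup m) : avg A g x < ∞ :=
  ENNReal.mul_lt_top (ENNReal.natCast_lt_top _) ((setLIntegral_le_lintegral _ _).trans_lt hg.lt_top)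

-- The standing assumption `m_k ≥ 2` is carried as a `Fact`, so that `ZMod (m k)` is found to be
-- finite and the measures to be probability measures by instance search.
instance isProbabilityMeasure_factorMeasure_of_fact [hm : Fact (∀ k, 2 ≤ m k)] (k : ℕ) :
    IsProbabilityMeasure (factorMeasure m k) :=
  isProbabilityMeasure_factorMeasure m hm.out k

instance neZero_of_fact [hm : Fact (∀ k, 2 ≤ m k)] (k : ℕ) : NeZero (m k) :=
  ⟨by have := hm.out k; omega⟩

variable [hm : Fact (∀ k, 2 ≤ m k)]

instance : IsProbabilityMeasure (haar m) := by
  unfold haar; infer_instance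

theorem measurePreserving_add_right (c : VilenkinGroup m) :
    MeasurePreserving (fun x => x + c) (haar m) (haar m) := by
  refine ⟨measurable_pi_lambda _ fun k => ?_, ?_⟩
  · exact (measurable_of_countable fun a : ZMod (m k) => a + c k).comp (measurable_pi_apply k)
  · have h := Measure.infinitePi_map_pi (μ := factorMeasure m) (f := fun k a => a + c k)
      (fun k => measurable_of_countable _)
    have hk : ∀ k, (factorMeasure m k).map (fun a => a + c k) = factorMeasure m k := by
      intro k
      refine Measure.ext_of_singleton fun a => ?_
      rw [Measure.map_apply (measurable_of_countable _) (measurableSet_singleton _)]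
      have : (fun a => a + c k) ⁻¹' {a} = {a - c k} := by
        ext b; exact eq_sub_iff_add_eq.symm
      rw [this, factorMeasure_singleton, factorMeasure_singleton]
    simp only [hk] at h
    exact h

theorem lintegral_add_right (c : VilenkinGroup m) {g : VilenkinGroup m → ℝ≥0∞}
    (hg : Measurable g) : ∫⁻ x, g (x + c) ∂haar m = ∫⁻ x, g x ∂haar m :=
  (measurePreserving_add_right c).lintegral_comp hg

theorem haar_interval (A : ℕ) (x : VilenkinGroup m) :
    haar m (interval m A x) = (genPow m A : ℝ≥0∞)⁻¹ := by
  have h : interval m A x = Set.pi (Finset.range A) fun k => {x k} := by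
    ext y; simp [interval, Set.mem_pi]
  rw [h, haar, Measure.infinitePi_pi _ (fun k _ => measurableSet_singleton _)]
  simp only [factorMeasure_singleton]
  induction A with
  | zero => simp [genPow]
  | succ k ih =>
    rw [Finset.prod_range_succ, ih (by ext y; simp [interval, Set.mem_pi]), genPow, Nat.cast_mul,
      ENNReal.mul_inv (Or.inr (ENNReal.natCast_ne_top _)) (Or.inl (ENNReal.natCast_ne_top _)),
      mul_comm]

theorem genPow_ne_zero (A : ℕ) : (genPow m A : ℝ≥0∞) ≠ 0 := by
  exact_mod_cast (genPow_pos hm.out A).ne'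

/-- The sets of `F_n` are unions of intervals of level `n`: membership depends only on the first
`n` coordinates. -/
theorem measurableSet_intervalAlgebra_iff {n : ℕ} {s : Set (VilenkinGroup m)} :
    MeasurableSet[intervalAlgebra m n] s ↔ ∀ x ∈ s, interval m n x ⊆ s := by
  constructor
  · intro hs
    suffices ∀ x y, y ∈ interval m n x → (x ∈ s ↔ y ∈ s) from
      fun x hx y hy => (this x y hy).mp hx
    induction s, hs using MeasurableSpace.generateFrom_induction with
    | hC t ht _ =>
      obtain ⟨z, rfl⟩ := ht
      intro x y hy
      exact ⟨fun h => interval_eq_of_mem h ▸ hy,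
        fun h => interval_eq_of_mem h ▸ mem_interval_comm.mp hy⟩
    | empty => simp
    | compl t _ ih => intro x y hy; simp [ih x y hy]
    | iUnion t _ ih => intro x y hy; simp [fun i => ih i x y hy]
  · intro hs
    have hc : (Set.range (interval m n)).Countable := by
      have : ∀ x : VilenkinGroup m, interval m n x =
          (fun u : ∀ k : Fin n, ZMod (m k) => {y : VilenkinGroup m | ∀ k : Fin n, y k = u k})
            (fun k => x k) := by
        intro x; ext y
        exact ⟨fun h k => h k k.2, fun h k hk => h ⟨k, hk⟩⟩
      refine (Set.countable_range (fun u : ∀ k : Fin n, ZMod (m k) =>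
        {y : VilenkinGroup m | ∀ k : Fin n, y k = u k})).mono ?_
      rintro _ ⟨x, rfl⟩
      exact ⟨_, (this x).symm⟩
    have : s = ⋃₀ {t ∈ Set.range (interval m n) | t ⊆ s} := by
      ext x
      constructor
      · intro hx
        exact ⟨interval m n x, ⟨⟨x, rfl⟩, hs x hx⟩, fun k _ => rfl⟩
      · rintro ⟨t, ⟨_, ht⟩, hx⟩
        exact ht hx
    rw [this]
    refine MeasurableSet.sUnion (hc.mono fun t ht => ht.1) fun t ht => ?_
    exact MeasurableSpace.measurableSet_generateFrom ht.1

theorem measurable_intervalAlgebra_of_dependsOn {β : Type*} [MeasurableSpace β] {n : ℕ}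
    {g : VilenkinGroup m → β} (hg : ∀ x, ∀ y ∈ interval m n x, g y = g x) :
    Measurable[intervalAlgebra m n] g := by
  intro s _
  refine measurableSet_intervalAlgebra_iff.mpr fun x hx y hy => ?_
  rw [Set.mem_preimage, hg x y hy]
  exact hx

theorem eq_of_measurable_intervalAlgebra {β : Type*} [MeasurableSpace β]
    [MeasurableSingletonClass β] {n : ℕ}
    {g : VilenkinGroup m → β} (hg : Measurable[intervalAlgebra m n] g) {x y : VilenkinGroup m}
    (hy : y ∈ interval m n x) : g y = g x :=
  measurableSet_intervalAlgebra_iff.mp (hg (measurableSet_singleton (g x))) x rfl hy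

theorem measurable_of_dependsOn {β : Type*} [MeasurableSpace β] {n : ℕ}
    {g : VilenkinGroup m → β} (hg : ∀ x, ∀ y ∈ interval m n x, g y = g x) : Measurable g :=
  (measurable_intervalAlgebra_of_dependsOn hg).mono (intervalAlgebra_le m n) le_rfl

theorem avg_of_dependsOn {A : ℕ} {g : VilenkinGroup m → ℝ≥0∞}
    (hg : ∀ x, ∀ y ∈ interval m A x, g y = g x) (x : VilenkinGroup m) : avg A g x = g x := by
  rw [avg, setLIntegral_congr_fun (measurableSet_interval A x) (fun y hy => hg x y hy),
    setLIntegral_const, haar_interval, mul_comm, mul_assoc,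
    ENNReal.inv_mul_cancel (genPow_ne_zero A) (ENNReal.natCast_ne_top _), mul_one]

theorem measurableSet_mem_interval (A : ℕ) :
    MeasurableSet {z : VilenkinGroup m × VilenkinGroup m | z.2 ∈ interval m A z.1} := by
  have : {z : VilenkinGroup m × VilenkinGroup m | z.2 ∈ interval m A z.1} =
      ⋂ k : ℕ, ⋂ _ : k < A, {z | z.2 k = z.1 k} := by
    ext z; simp [interval]
  rw [this]
  exact MeasurableSet.iInter fun k => MeasurableSet.iInter fun _ =>
    measurableSet_eq_fun ((measurable_pi_apply k).comp measurable_snd)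
      ((measurable_pi_apply k).comp measurable_fst)

/-- The averaging property of the conditional expectation, by Tonelli's theorem. -/
theorem lintegral_mul_avg {A : ℕ} {φ g : VilenkinGroup m → ℝ≥0∞} (hg : Measurable g)
    (hφ : ∀ x, ∀ y ∈ interval m A x, φ y = φ x) :
    ∫⁻ x, φ x * avg A g x ∂haar m = ∫⁻ x, φ x * g x ∂haar m := by
  have hφm : Measurable φ := measurable_of_dependsOn hφ
  set J : VilenkinGroup m → VilenkinGroup m → ℝ≥0∞ :=
    fun x y => (interval m A x).indicator (fun _ => 1) y with hJ
  have hJm : Measurable (Function.uncurry J) :=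
    measurable_const.indicator (measurableSet_mem_interval A)
  have hJs : ∀ x y, J x y = J y x := by
    intro x y
    by_cases h : y ∈ interval m A x
    · simp [hJ, h, mem_interval_comm.mp h]
    · simp [hJ, h, mt mem_interval_comm.mpr h]
  have h1 : ∀ u : VilenkinGroup m → ℝ≥0∞, ∀ x,
      avg A u x = ∫⁻ y, genPow m A * (J x y * u y) ∂haar m := by
    intro u x
    rw [avg, ← lintegral_indicator (measurableSet_interval A x),
      lintegral_const_mul' _ _ (ENNReal.natCast_ne_top _)]
    congr 1
    refine lintegral_congr fun y => ?_
    by_cases h : y ∈ interval m A x <;> simp [hJ, h]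
  calc ∫⁻ x, φ x * avg A g x ∂haar m
      = ∫⁻ x, ∫⁻ y, φ x * (genPow m A * (J x y * g y)) ∂haar m ∂haar m := by
        refine lintegral_congr fun x => ?_
        rw [h1, ← lintegral_const_mul]
        exact measurable_const.mul ((hJm.comp measurable_prodMk_left).mul hg)
    _ = ∫⁻ y, ∫⁻ x, φ x * (genPow m A * (J x y * g y)) ∂haar m ∂haar m := by
        refine lintegral_lintegral_swap (Measurable.aemeasurable ?_)
        exact (hφm.comp measurable_fst).mul (measurable_const.mul (hJm.mul (hg.comp measurable_snd)))
    _ = ∫⁻ y, φ y * g y ∂haar m := by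
        refine lintegral_congr fun y => ?_
        rw [← avg_of_dependsOn hφ y, h1, ← lintegral_mul_const]
        · refine lintegral_congr fun x => ?_
          rw [hJs x y]; ring
        · exact measurable_const.mul ((hJm.comp measurable_prodMk_left).mul hφm)

end

/-! ### Dirichlet and Fejér kernels -/

section

variable {m : ℕ → ℕ}

theorem digit_eq_zero {n k : ℕ} (h : n < genPow m k) : digit m n k = 0 := by
  simp [digit, Nat.div_eq_of_lt h]

/-- The points whose first `A` coordinates vanish, except possibly for the coordinate `s`. -/
def offDiag (m : ℕ → ℕ) (A s : ℕ) : Set (VilenkinGroup m) := {z | ∀ k < A, k ≠ s → z k = 0}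

theorem offDiag_self (A : ℕ) : offDiag m A A = interval m A 0 := by
  ext z
  exact ⟨fun h k hk => h k hk hk.ne, fun h k hk _ => h k hk⟩

/-- The majorant `∑_{s ≤ A} M_A M_s 1_{J(A, s)}` of the Fejér sums of order `M_A`, where `J(A, s)`
is the set of points whose first `A` coordinates other than `s` vanish. -/
def majorant (m : ℕ → ℕ) (A : ℕ) (z : VilenkinGroup m) : ℝ :=
  ∑ s ∈ Finset.range (A + 1), (offDiag m A s).indicator (fun _ => (genPow m A * genPow m s : ℝ)) z

theorem majorant_nonneg (A : ℕ) (z : VilenkinGroup m) : 0 ≤ majorant m A z :=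
  Finset.sum_nonneg fun s _ => Set.indicator_nonneg (fun _ _ => by positivity) _

variable [hm : Fact (∀ k, 2 ≤ m k)]

theorem rademacher_eq_stdAddChar (k : ℕ) (x : VilenkinGroup m) :
    rademacher m k x = ZMod.stdAddChar (x k) := by
  have h := ZMod.stdAddChar_coe (N := m k) ((x k).val : ℤ)
  rw [Int.cast_natCast, ZMod.natCast_zmod_val] at h
  rw [h, rademacher, Int.cast_natCast]

theorem norm_rademacher (k : ℕ) (x : VilenkinGroup m) : ‖rademacher m k x‖ = 1 := by
  rw [rademacher_eq_stdAddChar, ZMod.stdAddChar_apply, Circle.norm_coe]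

theorem rademacher_sub (k : ℕ) (x y : VilenkinGroup m) :
    rademacher m k (x - y) = rademacher m k x * conj (rademacher m k y) := by
  simp only [rademacher_eq_stdAddChar]
  rw [Pi.sub_apply, sub_eq_add_neg, AddChar.map_add_eq_mul, AddChar.map_neg_eq_conj]

theorem norm_psi (n : ℕ) (x : VilenkinGroup m) : ‖psi m n x‖ = 1 := by
  simp [psi, norm_prod, norm_rademacher]

theorem psi_sub (n : ℕ) (x y : VilenkinGroup m) :
    psi m n (x - y) = psi m n x * conj (psi m n y) := by
  simp [psi, rademacher_sub, mul_pow, Finset.prod_mul_distrib, map_prod]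

/-- In the definition of `ψ_n` the product may be taken over any range that contains the nonzero
digits of `n`. -/
theorem psi_eq_prod {n K : ℕ} (h : n < genPow m K) (x : VilenkinGroup m) :
    psi m n x = ∏ k ∈ Finset.range K, rademacher m k x ^ digit m n k := by
  have key : ∀ L, n < genPow m L → ∏ k ∈ Finset.range L, rademacher m k x ^ digit m n k =
      ∏ k ∈ Finset.range (max n K), rademacher m k x ^ digit m n k := by
    intro L hL
    rcases le_total L (max n K) with hle | hle
    · refine Finset.prod_subset (Finset.range_mono hle) fun k _ hk => ?_
      rw [digit_eq_zero (hL.trans_le (genPow_mono hm.out (by simpa using hk))), pow_zero]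
    · refine (Finset.prod_subset (Finset.range_mono hle) fun k _ hk => ?_).symm
      have hk' : n ≤ k := (le_max_left n K).trans (by simpa using hk)
      rw [digit_eq_zero ((lt_genPow hm.out n).trans_le (genPow_mono hm.out hk')), pow_zero]
  rw [psi, key n (lt_genPow hm.out n), key K h]

theorem psi_eq_of_mem {n A : ℕ} (h : n < genPow m A) {x y : VilenkinGroup m}
    (hy : y ∈ interval m A x) : psi m n y = psi m n x := by
  rw [psi_eq_prod h, psi_eq_prod h]
  refine Finset.prod_congr rfl fun k hk => ?_
  rw [rademacher, rademacher, hy k (Finset.mem_range.mp hk)]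

/-- The Vilenkin functions of the block `c M_A ≤ n < (c + 1) M_A` are modulations by `r_A ^ c` of
those of the first block. -/
theorem psi_mul_add {A c d : ℕ} (hc : c < m A) (hd : d < genPow m A) (x : VilenkinGroup m) :
    psi m (c * genPow m A + d) x = rademacher m A x ^ c * psi m d x := by
  have hpos := genPow_pos hm.out
  have hlt : c * genPow m A + d < genPow m (A + 1) := by
    have : (c + 1) * genPow m A ≤ m A * genPow m A := Nat.mul_le_mul_right _ hc
    simp only [genPow]
    linarith [add_one_mul c (genPow m A)]
  rw [psi_eq_prod hlt, psi_eq_prod hd, Finset.prod_range_succ, mul_comm]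
  congr 1
  · congr 1
    rw [digit, mul_comm, Nat.mul_add_div (hpos A), Nat.div_eq_of_lt hd, add_zero,
      Nat.mod_eq_of_lt hc]
  · refine Finset.prod_congr rfl fun k hk => ?_
    congr 1
    obtain ⟨t, ht⟩ := genPow_dvd (m := m) (Finset.mem_range.mp hk : k + 1 ≤ A)
    rw [digit, digit]
    have : c * genPow m A + d = genPow m k * (m k * (t * c)) + d := by
      rw [ht, genPow]; ring
    rw [this, Nat.mul_add_div (hpos k), Nat.mul_add_mod]

theorem sum_rademacher_pow (A : ℕ) (z : VilenkinGroup m) :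
    ∑ c ∈ Finset.range (m A), rademacher m A z ^ c = if z A = 0 then (m A : ℂ) else 0 := by
  split_ifs with h
  · simp [rademacher_eq_stdAddChar, h]
  · have h1 : rademacher m A z ≠ 1 := by
      rw [rademacher_eq_stdAddChar]
      intro h1
      exact h (ZMod.injective_stdAddChar (by rw [h1, AddChar.map_zero_eq_one]))
    have h2 : rademacher m A z ^ m A = 1 := by
      rw [rademacher_eq_stdAddChar, ← AddChar.map_nsmul_eq_pow]
      simp
    rw [geom_sum_eq h1, h2, sub_self, zero_div]

variable (m) in
/-- The Dirichlet kernel `D_n = ∑_{i < n} ψ_i`. -/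
def dirichlet (n : ℕ) (z : VilenkinGroup m) : ℂ := ∑ i ∈ Finset.range n, psi m i z

variable (m) in
/-- The unnormalized Fejér kernel `n K_n = ∑_{k=1}^n D_k`, indexed so that the sum runs over
`D_{k + 1}` for `k < n`. -/
def fejerSum (n : ℕ) (z : VilenkinGroup m) : ℂ := ∑ k ∈ Finset.range n, dirichlet m (k + 1) z

theorem dirichlet_mul_add {A c d : ℕ} (hc : c < m A) (hd : d ≤ genPow m A) (z : VilenkinGroup m) :
    dirichlet m (c * genPow m A + d) z =
      dirichlet m (c * genPow m A) z + rademacher m A z ^ c * dirichlet m d z := by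
  rw [dirichlet, Finset.sum_range_add, dirichlet, dirichlet, Finset.mul_sum]
  congr 1
  exact Finset.sum_congr rfl fun i hi =>
    psi_mul_add hc ((Finset.mem_range.mp hi).trans_le hd) z

theorem dirichlet_mul {A c : ℕ} (hc : c ≤ m A) (z : VilenkinGroup m) :
    dirichlet m (c * genPow m A) z =
      (∑ i ∈ Finset.range c, rademacher m A z ^ i) * dirichlet m (genPow m A) z := by
  induction c with
  | zero => simp [dirichlet]
  | succ c ih =>
    rw [add_one_mul, dirichlet_mul_add hc le_rfl, ih (by omega), Finset.sum_range_succ, add_mul]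

/-- Paley's lemma: `D_{M_A} = M_A 1_{I_A(0)}`. -/
theorem dirichlet_genPow (A : ℕ) (z : VilenkinGroup m) :
    dirichlet m (genPow m A) z = (interval m A 0).indicator (fun _ => (genPow m A : ℂ)) z := by
  induction A with
  | zero => simp [genPow, dirichlet, psi, interval]
  | succ A ih =>
    have h := dirichlet_mul (m := m) (A := A) le_rfl z
    rw [genPow, h, ih, sum_rademacher_pow]
    have hiff : z ∈ interval m (A + 1) 0 ↔ z A = 0 ∧ z ∈ interval m A 0 := by
      simp only [interval, Set.mem_ofPred_eq, Nat.lt_succ_iff_lt_or_eq]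
      constructor
      · exact fun h => ⟨h A (Or.inr rfl), fun k hk => h k (Or.inl hk)⟩
      · rintro ⟨h1, h2⟩ k (hk | rfl)
        exacts [h2 k hk, h1]
    by_cases h1 : z A = 0 <;> by_cases h2 : z ∈ interval m A 0 <;> simp [hiff, h1, h2]

theorem fejerSum_mul_add {A c d : ℕ} (hc : c < m A) (hd : d ≤ genPow m A) (z : VilenkinGroup m) :
    fejerSum m (c * genPow m A + d) z = fejerSum m (c * genPow m A) z +
      d * dirichlet m (c * genPow m A) z + rademacher m A z ^ c * fejerSum m d z := by
  rw [fejerSum, Finset.sum_range_add, fejerSum, fejerSum, Finset.mul_sum, add_assoc]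
  congr 1
  rw [Finset.sum_congr rfl fun k hk => (by
    rw [add_assoc, dirichlet_mul_add hc ((Nat.succ_le_iff.mpr (Finset.mem_range.mp hk)).trans hd)] :
      dirichlet m (c * genPow m A + k + 1) z = _)]
  rw [Finset.sum_add_distrib]
  simp

theorem norm_sum_rademacher_pow_le (A c : ℕ) (z : VilenkinGroup m) :
    ‖∑ i ∈ Finset.range c, rademacher m A z ^ i‖ ≤ c := by
  refine (norm_sum_le _ _).trans ?_
  simp [norm_rademacher]

theorem norm_dirichlet_mul_le {A c : ℕ} (hc : c ≤ m A) (z : VilenkinGroup m) :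
    ‖dirichlet m (c * genPow m A) z‖ ≤ m A * ‖dirichlet m (genPow m A) z‖ := by
  rw [dirichlet_mul hc, norm_mul]
  gcongr
  exact (norm_sum_rademacher_pow_le A c z).trans (by exact_mod_cast hc)

/-- The difference between the Fejér sum over `c` full blocks and the modulated sum of the first
block is controlled by the Dirichlet kernel of order `M_A`. -/
theorem norm_fejerSum_mul_sub_le {A c : ℕ} (hc : c ≤ m A) (z : VilenkinGroup m) :
    ‖fejerSum m (c * genPow m A) z -
        (∑ i ∈ Finset.range c, rademacher m A z ^ i) * fejerSum m (genPow m A) z‖ ≤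
      c * (m A * (genPow m A * ‖dirichlet m (genPow m A) z‖)) := by
  induction c with
  | zero => simp [fejerSum]
  | succ c ih =>
    rw [add_one_mul, fejerSum_mul_add hc le_rfl, Finset.sum_range_succ]
    have h1 := ih (by omega)
    have h2 := norm_dirichlet_mul_le (A := A) (c := c) (by omega) z
    calc _ = ‖(fejerSum m (c * genPow m A) z -
        (∑ i ∈ Finset.range c, rademacher m A z ^ i) * fejerSum m (genPow m A) z) +
          genPow m A * dirichlet m (c * genPow m A) z‖ := by congr 1; ring
      _ ≤ c * (m A * (genPow m A * ‖dirichlet m (genPow m A) z‖)) +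
          genPow m A * (m A * ‖dirichlet m (genPow m A) z‖) := by
        refine (norm_add_le _ _).trans (add_le_add h1 ?_)
        rw [norm_mul, Complex.norm_natCast]
        gcongr
      _ = _ := by push_cast; ring

theorem genPow_mul_norm_dirichlet_le (A : ℕ) (z : VilenkinGroup m) :
    genPow m A * ‖dirichlet m (genPow m A) z‖ ≤ majorant m A z := by
  rw [dirichlet_genPow, majorant, Finset.sum_range_succ, offDiag_self]
  refine le_add_of_nonneg_of_le
    (Finset.sum_nonneg fun s _ => Set.indicator_nonneg (fun _ _ => by positivity) _) ?_
  by_cases h : z ∈ interval m A 0 <;> simp [h]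

/-- The Fejér sums of order `M_A`. In the step from `A` to `A + 1` the terms `s < A` are carried
over exactly; the term `s = A` at a point with `z_A = 0` goes into the new term `s = A + 1`, since
`2 M_A ≤ M_{A + 1}`, and the contribution of the Dirichlet kernel into the new term `s = A`. -/
theorem norm_fejerSum_genPow_le {b : ℕ} (hb : ∀ k, m k ≤ b) (A : ℕ) (z : VilenkinGroup m) :
    ‖fejerSum m (genPow m A) z‖ ≤ b * majorant m A z := by
  have hb1 : (1 : ℝ) ≤ b := by exact_mod_cast (by have := hm.out 0; have := hb 0; omega : 1 ≤ b)
  induction A with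
  | zero =>
    simp [genPow, fejerSum, dirichlet, psi, majorant, offDiag, hb1]
  | succ A ih =>
    have h := norm_fejerSum_mul_sub_le (m := m) (A := A) le_rfl z
    rw [sum_rademacher_pow] at h
    have hmA : (m A : ℝ) ≤ b := by exact_mod_cast hb A
    have hM : (0 : ℝ) ≤ genPow m A := Nat.cast_nonneg _
    have h2 : (2 : ℝ) * genPow m A ≤ genPow m (A + 1) := by
      exact_mod_cast two_mul_genPow_le hm.out A
    have hG : (genPow m (A + 1) : ℝ) = m A * genPow m A := by rw [genPow]; push_cast; ring
    -- the contribution of the Dirichlet kernel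
    have hD : (m A : ℝ) * (m A * (genPow m A * ‖dirichlet m (genPow m A) z‖)) ≤
        b * (offDiag m (A + 1) A).indicator
          (fun _ => (genPow m (A + 1) * genPow m A : ℝ)) z := by
      rw [dirichlet_genPow]
      by_cases hz : z ∈ interval m A 0
      · have hz' : z ∈ offDiag m (A + 1) A := fun k hk hkA => hz k (by omega)
        simp only [hz, hz', Set.indicator_of_mem, Complex.norm_natCast, hG]
        nlinarith [mul_nonneg (mul_nonneg (Nat.cast_nonneg (α := ℝ) (m A)) hM) hM]
      · simp only [hz, not_false_eq_true, Set.indicator_of_notMem, norm_zero, mul_zero]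
        exact mul_nonneg (Nat.cast_nonneg _) (Set.indicator_nonneg (fun _ _ => by positivity) _)
    -- the contribution of the Fejér sum of the previous order
    have hF : ‖(if z A = 0 then (m A : ℂ) else 0) * fejerSum m (genPow m A) z‖ ≤
        b * (∑ s ∈ Finset.range A, (offDiag m (A + 1) s).indicator
            (fun _ => (genPow m (A + 1) * genPow m s : ℝ)) z +
          (offDiag m (A + 1) (A + 1)).indicator
            (fun _ => (genPow m (A + 1) * genPow m (A + 1) : ℝ)) z) := by
      have hnn : (0 : ℝ) ≤ b * (∑ s ∈ Finset.range A, (offDiag m (A + 1) s).indicator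
            (fun _ => (genPow m (A + 1) * genPow m s : ℝ)) z +
          (offDiag m (A + 1) (A + 1)).indicator
            (fun _ => (genPow m (A + 1) * genPow m (A + 1) : ℝ)) z) :=
        mul_nonneg (Nat.cast_nonneg _) (add_nonneg
          (Finset.sum_nonneg fun s _ => Set.indicator_nonneg (fun _ _ => by positivity) _)
          (Set.indicator_nonneg (fun _ _ => by positivity) _))
      split_ifs with hzA
      · rw [norm_mul, Complex.norm_natCast]
        calc (m A : ℝ) * ‖fejerSum m (genPow m A) z‖ ≤ m A * (b * majorant m A z) := by gcongr
          _ = b * (m A * majorant m A z) := by ring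
          _ ≤ _ := by
            gcongr
            rw [majorant, Finset.sum_range_succ, mul_add, Finset.mul_sum]
            refine add_le_add (Finset.sum_le_sum fun s hs => ?_) ?_
            · by_cases hz : z ∈ offDiag m A s
              · have hz' : z ∈ offDiag m (A + 1) s := by
                  intro k hk hks
                  rcases Nat.lt_succ_iff_lt_or_eq.mp hk with h | rfl
                  exacts [hz k h hks, hzA]
                simp only [hz, hz', Set.indicator_of_mem, hG]
                exact le_of_eq (by ring)
              · simp only [hz, not_false_eq_true, Set.indicator_of_notMem, mul_zero]
                exact Set.indicator_nonneg (fun _ _ => by positivity) _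
            · by_cases hz : z ∈ offDiag m A A
              · have hz' : z ∈ offDiag m (A + 1) (A + 1) := by
                  intro k hk hks
                  rcases Nat.lt_succ_iff_lt_or_eq.mp hk with h | rfl
                  exacts [hz k h h.ne, hzA]
                simp only [hz, hz', Set.indicator_of_mem]
                rw [← mul_assoc, ← hG]
                gcongr
                exact genPow_mono hm.out (Nat.le_succ A)
              · simp only [hz, not_false_eq_true, Set.indicator_of_notMem, mul_zero]
                exact Set.indicator_nonneg (fun _ _ => by positivity) _
      · simpa using hnn
    calc ‖fejerSum m (genPow m (A + 1)) z‖
        ≤ ‖fejerSum m (genPow m (A + 1)) z -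
            (if z A = 0 then (m A : ℂ) else 0) * fejerSum m (genPow m A) z‖ +
          ‖(if z A = 0 then (m A : ℂ) else 0) * fejerSum m (genPow m A) z‖ :=
          norm_le_norm_sub_add _ _
      _ ≤ _ := add_le_add (h.trans hD) hF
      _ = b * majorant m (A + 1) z := by
        rw [majorant, Finset.sum_range_succ _ (A + 1), Finset.sum_range_succ _ A]
        ring

/-- Pointwise bound of the Fejér sums of arbitrary order, by induction on the number of digits of
`n`: the leading digit is split off in each step. -/
theorem norm_fejerSum_le {b : ℕ} (hb : ∀ k, m k ≤ b) {N n : ℕ} (hn : n < genPow m (N + 1))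
    (z : VilenkinGroup m) :
    ‖fejerSum m n z‖ ≤ (2 * b ^ 2 + b) * ∑ A ∈ Finset.range (N + 1), majorant m A z := by
  have hb1 : (1 : ℝ) ≤ b := by exact_mod_cast (by have := hm.out 0; have := hb 0; omega : 1 ≤ b)
  -- the leading digit `c` below may be zero, so the range of `n` has no lower bound
  suffices ∀ N n, n < genPow m N →
      ‖fejerSum m n z‖ ≤ (2 * b ^ 2 + b) * ∑ A ∈ Finset.range N, majorant m A z from
    this _ _ hn
  clear hn N n
  intro N
  induction N with
  | zero => intro n hn; simp only [genPow, Nat.lt_one_iff] at hn; simp [hn, fejerSum]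
  | succ N ih =>
    intro n hn
    set c := n / genPow m N with hc
    set d := n % genPow m N with hd
    have hpos := genPow_pos hm.out N
    have hcm : c < m N := by
      rw [hc, Nat.div_lt_iff_lt_mul hpos]; exact hn
    have hdM : d < genPow m N := Nat.mod_lt _ hpos
    have hnd : n = c * genPow m N + d := by rw [mul_comm]; exact (Nat.div_add_mod _ _).symm
    have hmN : (m N : ℝ) ≤ b := by exact_mod_cast hb N
    have hcb : (c : ℝ) ≤ b := le_trans (by exact_mod_cast hcm.le) hmN
    have hdM' : (d : ℝ) ≤ genPow m N := by exact_mod_cast hdM.le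
    have h1 := norm_fejerSum_mul_sub_le (A := N) hcm.le z
    have h2 := genPow_mul_norm_dirichlet_le N z
    have h3 := norm_fejerSum_genPow_le hb N z
    have h4 := norm_sum_rademacher_pow_le N c z
    have h5 := norm_dirichlet_mul_le hcm.le z
    have hΦ := majorant_nonneg N z
    have e1 : ‖fejerSum m (c * genPow m N) z‖ ≤ 2 * b ^ 2 * majorant m N z := by
      calc ‖fejerSum m (c * genPow m N) z‖ ≤ _ := norm_le_norm_sub_add _
            ((∑ i ∈ Finset.range c, rademacher m N z ^ i) * fejerSum m (genPow m N) z)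
        _ ≤ b * (b * majorant m N z) + b * (b * majorant m N z) := by
            refine add_le_add (h1.trans (by gcongr)) ?_
            rw [norm_mul]
            gcongr
            exact h4.trans hcb
        _ = _ := by ring
    have e2 : ‖(d : ℂ) * dirichlet m (c * genPow m N) z‖ ≤ b * majorant m N z := by
      rw [norm_mul, Complex.norm_natCast]
      calc (d : ℝ) * ‖dirichlet m (c * genPow m N) z‖
          ≤ genPow m N * (b * ‖dirichlet m (genPow m N) z‖) := by
            gcongr
            exact h5.trans (by gcongr)
        _ = b * (genPow m N * ‖dirichlet m (genPow m N) z‖) := by ring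
        _ ≤ _ := by gcongr
    have e3 : ‖rademacher m N z ^ c * fejerSum m d z‖ ≤
        (2 * b ^ 2 + b) * ∑ A ∈ Finset.range N, majorant m A z := by
      rw [norm_mul, norm_pow, norm_rademacher, one_pow, one_mul]
      exact ih d hdM
    rw [hnd, fejerSum_mul_add hcm hdM.le, Finset.sum_range_succ]
    refine (norm_add₃_le).trans ((add_le_add (add_le_add e1 e2) e3).trans (le_of_eq (by ring)))

end

/-! ### Fejér sums of a martingale -/

section

variable {m : ℕ → ℕ}

variable [hm : Fact (∀ k, 2 ≤ m k)]

theorem stronglyMeasurable_psi {i A : ℕ} (hi : i < genPow m A) :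
    StronglyMeasurable[intervalAlgebra m A] (psi m i) :=
  (measurable_intervalAlgebra_of_dependsOn fun _ _ hy => psi_eq_of_mem hi hy).stronglyMeasurable

theorem measurable_psi (i : ℕ) : Measurable (psi m i) :=
  measurable_of_dependsOn fun _ _ hy => psi_eq_of_mem (lt_genPow hm.out i) hy

theorem integrable_mul_conj_psi {g : VilenkinGroup m → ℂ} (hg : Integrable g (haar m)) (i : ℕ) :
    Integrable (fun x => g x * conj (psi m i x)) (haar m) := by
  refine hg.mul_bdd (c := 1) ?_ (Eventually.of_forall fun x => ?_)
  · exact (Complex.continuous_conj.measurable.comp (measurable_psi i)).aestronglyMeasurable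
  · simp [norm_psi]

/-- The integrals defining the Vilenkin-Fourier coefficients of a martingale are eventually
constant. -/
theorem integral_martingale_mul_conj_psi {f : ℕ → VilenkinGroup m → ℂ}
    (hf : Martingale f (filtration m) (haar m)) {i A k : ℕ} (hi : i < genPow m A) (hk : A ≤ k) :
    ∫ x, f k x * conj (psi m i x) ∂haar m = ∫ x, f A x * conj (psi m i x) ∂haar m := by
  have hψ : StronglyMeasurable[filtration m A] fun x => conj (psi m i x) :=
    Complex.continuous_conj.comp_stronglyMeasurable (stronglyMeasurable_psi hi)
  have h1 := condExp_bilin_of_stronglyMeasurable_right (ContinuousLinearMap.mul ℝ ℂ)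
    (μ := haar m) (f := f k) hψ (integrable_mul_conj_psi (hf.integrable k) i) (hf.integrable k)
  calc ∫ x, f k x * conj (psi m i x) ∂haar m
      = ∫ x, ((haar m)[fun x => f k x * conj (psi m i x) | filtration m A]) x ∂haar m :=
        (integral_condExp ((filtration m).le A)).symm
    _ = ∫ x, f A x * conj (psi m i x) ∂haar m := by
        refine integral_congr_ae (h1.trans ?_)
        filter_upwards [hf.condExp_ae_eq hk] with x hx
        simp [hx]

theorem vilenkinCoeff_eq {f : ℕ → VilenkinGroup m → ℂ}
    (hf : Martingale f (filtration m) (haar m)) {i A : ℕ} (hi : i < genPow m A) :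
    vilenkinCoeff m f i = ∫ x, f A x * conj (psi m i x) ∂haar m := by
  refine Tendsto.limUnder_eq (tendsto_const_nhds.congr' ?_)
  filter_upwards [eventually_ge_atTop A] with k hk
  exact (integral_martingale_mul_conj_psi hf hi hk).symm

/-- Sums of partial sums are convolutions with Fejér sums. -/
theorem sum_partialSum_eq {f : ℕ → VilenkinGroup m → ℂ}
    (hf : Martingale f (filtration m) (haar m)) {n A : ℕ} (hn : n ≤ genPow m A)
    (x : VilenkinGroup m) :
    ∑ k ∈ Finset.range n, partialSum m f (k + 1) x =
      ∫ y, f A y * fejerSum m n (x - y) ∂haar m := by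
  have hterm : ∀ i, i < genPow m A → vilenkinCoeff m f i * psi m i x =
      ∫ y, f A y * psi m i (x - y) ∂haar m := by
    intro i hi
    rw [vilenkinCoeff_eq hf hi, ← integral_mul_const]
    refine integral_congr_ae (Eventually.of_forall fun y => ?_)
    simp only [psi_sub]
    ring
  have hint : ∀ i, Integrable (fun y => f A y * psi m i (x - y)) (haar m) := by
    intro i
    refine ((integrable_mul_conj_psi (hf.integrable A) i).mul_const (psi m i x)).congr
      (Eventually.of_forall fun y => ?_)
    simp only [psi_sub]
    ring
  simp only [fejerSum, dirichlet, Finset.mul_sum]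
  rw [integral_finsetSum _ fun k _ => integrable_finsetSum _ fun i _ => hint i]
  refine Finset.sum_congr rfl fun k hk => ?_
  rw [integral_finsetSum _ fun i _ => hint i, partialSum]
  refine Finset.sum_congr rfl fun i hi => hterm i ?_
  have := Finset.mem_range.mp hk
  have := Finset.mem_range.mp hi
  omega

/-- The convolution of `g` with the majorant of the Fejér sums of order `M_A` is controlled by
translates of the conditional expectation `avg A g` in the coordinates `s ≤ A`. -/
theorem lintegral_mul_majorant_le (A : ℕ) {g : VilenkinGroup m → ℝ≥0∞} (hg : Measurable g)
    (x : VilenkinGroup m) :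
    ∫⁻ y, g y * ENNReal.ofReal (majorant m A (x - y)) ∂haar m ≤
      ∑ s ∈ Finset.range (A + 1), ∑ j : ZMod (m s), genPow m s * avg A g (x + Pi.single s j) := by
  have hpt : ∀ y, g y * ENNReal.ofReal (majorant m A (x - y)) ≤
      ∑ s ∈ Finset.range (A + 1), ∑ j : ZMod (m s), (genPow m s * genPow m A : ℝ≥0∞) *
        (interval m A (x + Pi.single s j)).indicator g y := by
    intro y
    rw [majorant, ENNReal.ofReal_sum_of_nonneg
      fun s _ => Set.indicator_nonneg (fun _ _ => by positivity) _, Finset.mul_sum]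
    refine Finset.sum_le_sum fun s _ => ?_
    by_cases h : x - y ∈ offDiag m A s
    · have hy : y ∈ interval m A (x + Pi.single s (y s - x s)) := by
        intro k hk
        by_cases hks : k = s
        · subst hks; simp
        · have := h k hk hks
          rw [Pi.sub_apply, sub_eq_zero] at this
          simp [hks, this]
      refine le_trans (le_of_eq ?_) (Finset.single_le_sum (fun j _ => zero_le)
        (Finset.mem_univ (y s - x s)))
      rw [Set.indicator_of_mem h, Set.indicator_of_mem hy, ENNReal.ofReal_mul (by positivity),
        ENNReal.ofReal_natCast, ENNReal.ofReal_natCast]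
      ring
    · simp [h]
  refine (lintegral_mono hpt).trans (le_of_eq ?_)
  have hmeas : ∀ (s : ℕ) (j : ZMod (m s)), Measurable fun y => (genPow m s * genPow m A : ℝ≥0∞) *
      (interval m A (x + Pi.single s j)).indicator g y := fun s j =>
    measurable_const.mul (hg.indicator (measurableSet_interval A _))
  rw [lintegral_finsetSum _ fun s _ => Finset.measurable_sum _ fun j _ => hmeas s j]
  refine Finset.sum_congr rfl fun s _ => ?_
  rw [lintegral_finsetSum _ fun j _ => hmeas s j]
  refine Finset.sum_congr rfl fun j _ => ?_
  rw [lintegral_const_mul _ (hg.indicator (measurableSet_interval A _)),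
    lintegral_indicator (measurableSet_interval A _), avg, mul_assoc]

/-- The sums of partial sums of order `n` in terms of conditional expectations of
`|f^{(N + 1)}|`. -/
theorem enorm_sum_partialSum_le {b : ℕ} (hb : ∀ k, m k ≤ b) {f : ℕ → VilenkinGroup m → ℂ}
    (hf : Martingale f (filtration m) (haar m)) {n N : ℕ} (hn : n < genPow m (N + 1))
    (x : VilenkinGroup m) :
    ‖∑ k ∈ Finset.range n, partialSum m f (k + 1) x‖ₑ ≤
      ((2 * b ^ 2 + b : ℕ) : ℝ≥0∞) * ∑ A ∈ Finset.range (N + 1), ∑ s ∈ Finset.range (A + 1),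
        ∑ j : ZMod (m s), genPow m s * avg A (fun y => ‖f (N + 1) y‖ₑ) (x + Pi.single s j) := by
  have hfm : Measurable fun y => ‖f (N + 1) y‖ₑ :=
    ((hf.stronglyMeasurable (N + 1)).mono ((filtration m).le _)).measurable.enorm
  have hsub : Measurable fun y : VilenkinGroup m => x - y :=
    measurable_pi_lambda _ fun k =>
      (measurable_of_countable fun a : ZMod (m k) => x k - a).comp (measurable_pi_apply k)
  have hmaj : ∀ A, Measurable fun y => ENNReal.ofReal (majorant m A (x - y)) := by
    intro A
    refine ENNReal.measurable_ofReal.comp (Measurable.comp (g := majorant m A) ?_ hsub)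
    refine measurable_of_dependsOn (n := A) fun u v hv => ?_
    refine Finset.sum_congr rfl fun s _ => ?_
    have : v ∈ offDiag m A s ↔ u ∈ offDiag m A s :=
      ⟨fun h k hk hks => hv k hk ▸ h k hk hks, fun h k hk hks => (hv k hk).trans (h k hk hks)⟩
    by_cases h : u ∈ offDiag m A s
    · simp [h, this.mpr h]
    · simp [h, mt this.mp h]
  have hprod : ∀ A, Measurable fun y =>
      ‖f (N + 1) y‖ₑ * ENNReal.ofReal (majorant m A (x - y)) := fun A => hfm.mul (hmaj A)
  rw [sum_partialSum_eq hf hn.le x]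
  calc _ ≤ ∫⁻ y, ‖f (N + 1) y * fejerSum m n (x - y)‖ₑ ∂haar m := enorm_integral_le_lintegral_enorm _
    _ ≤ ∫⁻ y, ((2 * b ^ 2 + b : ℕ) : ℝ≥0∞) * ∑ A ∈ Finset.range (N + 1),
          ‖f (N + 1) y‖ₑ * ENNReal.ofReal (majorant m A (x - y)) ∂haar m := by
        refine lintegral_mono fun y => ?_
        rw [enorm_mul, ← Finset.mul_sum, mul_left_comm]
        gcongr
        rw [← ofReal_norm, ← ENNReal.ofReal_natCast,
          ← ENNReal.ofReal_sum_of_nonneg fun A _ => majorant_nonneg A _,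
          ← ENNReal.ofReal_mul (by positivity)]
        refine ENNReal.ofReal_le_ofReal ((norm_fejerSum_le hb hn _).trans (le_of_eq ?_))
        push_cast; rfl
    _ = ((2 * b ^ 2 + b : ℕ) : ℝ≥0∞) * ∑ A ∈ Finset.range (N + 1),
          ∫⁻ y, ‖f (N + 1) y‖ₑ * ENNReal.ofReal (majorant m A (x - y)) ∂haar m := by
        rw [lintegral_const_mul _ (Finset.measurable_sum _ fun A _ => hprod A),
          lintegral_finsetSum _ fun A _ => hprod A]
    _ ≤ _ := by
        gcongr with A hA
        exact lintegral_mul_majorant_le A hfm x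

end

/-! ### Riesz means and Fejér means -/

section

variable {m : ℕ → ℕ}

/-- Riesz means are averages of Fejér means: summation by parts. -/
theorem norm_rieszMean_le {f : ℕ → VilenkinGroup m → ℂ} {x : VilenkinGroup m} {V : ℝ}
    (hV0 : 0 ≤ V)
    (hV : ∀ n, ‖∑ k ∈ Finset.range n, partialSum m f (k + 1) x‖ ≤ n * V) (n : ℕ) :
    ‖rieszMean m f n x‖ ≤ V := by
  rcases Nat.eq_zero_or_pos n with rfl | hn
  · simpa [rieszMean] using hV0
  set T : ℕ → ℂ := fun n => ∑ k ∈ Finset.range n, partialSum m f (k + 1) x with hT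
  have hpos : ∀ n, 1 ≤ n → 1 ≤ logWeight n := by
    intro n hn
    have h1 : (1 : ℕ) ∈ Finset.Icc 1 n := by simp [hn]
    have := Finset.single_le_sum (f := fun k : ℕ => 1 / (k : ℝ))
      (fun k _ => by positivity) h1
    simpa [logWeight] using this
  have key : ∀ n, 1 ≤ n → ‖∑ k ∈ Finset.Icc 1 n, partialSum m f k x / (k : ℂ) - T n / n‖ ≤
      V * (logWeight n - 1) := by
    intro n hn
    induction n, hn using Nat.le_induction with
    | base => simp [hT, logWeight]
    | succ n hn ih =>
      have hn0 : (n : ℂ) ≠ 0 := by exact_mod_cast (by omega : n ≠ 0)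
      have hn1 : (n : ℂ) + 1 ≠ 0 := by exact_mod_cast (by omega : n + 1 ≠ 0)
      have hTs : T (n + 1) = T n + partialSum m f (n + 1) x := Finset.sum_range_succ _ _
      rw [Finset.sum_Icc_succ_top (by omega), logWeight, Finset.sum_Icc_succ_top (by omega),
        ← logWeight, hTs]
      have e : ∑ k ∈ Finset.Icc 1 n, partialSum m f k x / (k : ℂ) +
          partialSum m f (n + 1) x / ((n + 1 : ℕ) : ℂ) -
            (T n + partialSum m f (n + 1) x) / ((n + 1 : ℕ) : ℂ) =
          (∑ k ∈ Finset.Icc 1 n, partialSum m f k x / (k : ℂ) - T n / n) +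
            T n / (n * (n + 1)) := by
        push_cast; field_simp; ring
      rw [e]
      have h2 : ‖T n / (n * (n + 1) : ℂ)‖ ≤ V * (1 / ((n + 1 : ℕ) : ℝ)) := by
        have hc : ‖(n * (n + 1) : ℂ)‖ = n * (n + 1) := by
          rw [norm_mul, Complex.norm_natCast]
          congr 1
          exact_mod_cast Complex.norm_natCast (n + 1)
        have hnp : (0 : ℝ) < n := by exact_mod_cast hn
        rw [norm_div, hc, div_le_iff₀ (by positivity)]
        refine (hV n).trans (le_of_eq ?_)
        push_cast; field_simp
      refine (norm_add_le _ _).trans ((add_le_add ih h2).trans (le_of_eq (by ring)))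
  have hl := hpos n hn
  have hTn : ‖T n / n‖ ≤ V := by
    have hnp : (0 : ℝ) < n := by exact_mod_cast hn
    rw [norm_div, Complex.norm_natCast, div_le_iff₀ hnp, mul_comm]
    exact hV n
  have hsum : ‖∑ k ∈ Finset.Icc 1 n, partialSum m f k x / (k : ℂ)‖ ≤ V * logWeight n := by
    refine (norm_le_norm_sub_add _ (T n / n)).trans ((add_le_add (key n hn) hTn).trans ?_)
    exact le_of_eq (by ring)
  rw [rieszMean, norm_mul, norm_div, norm_one, Complex.norm_real, Real.norm_of_nonneg (by linarith),
    div_mul_eq_mul_div, one_mul, div_le_iff₀ (by linarith)]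
  exact hsum

end

/-! ### Doob's maximal inequality -/

section

theorem rpow_sub_one_mul_self (x : ℝ≥0∞) {r : ℝ} (hr : 1 ≤ r) : x ^ (r - 1) * x = x ^ r := by
  conv_lhs => rw [← ENNReal.rpow_one x]
  rw [← ENNReal.rpow_mul, one_mul, ← ENNReal.rpow_add_of_nonneg _ _ (by linarith) zero_le_one]
  congr 1; ring

theorem iSup_rpow {ι : Sort*} (u : ι → ℝ≥0∞) {r : ℝ} (hr : 0 < r) :
    (⨆ i, u i) ^ r = ⨆ i, u i ^ r :=
  (ENNReal.orderIsoRpow r hr).map_iSup u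

/-- The step inequality behind Doob's inequality when the running maximum `S` is updated by a new
value `s`; for `S ≤ s` it is Young's inequality. -/
theorem sup_rpow_add_le {r : ℝ} (hr : 1 < r) {S s : ℝ≥0∞} (hS : S ≠ ∞) (hs : s ≠ ∞) :
    (S ⊔ s) ^ r + ENNReal.ofReal (r / (r - 1)) * (S ^ (r - 1) * s) ≤
      S ^ r + ENNReal.ofReal (r / (r - 1)) * ((S ⊔ s) ^ (r - 1) * s) := by
  rcases le_total s S with h | h
  · rw [sup_eq_left.mpr h]
  rw [sup_eq_right.mpr h, rpow_sub_one_mul_self s hr.le]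
  have hr0 : 0 < r - 1 := by linarith
  set c := r / (r - 1) with hc
  have hconj : c.HolderConjugate r := (Real.HolderConjugate.conjExponent hr).symm
  have hc1 : 1 + c / r = c := by rw [hc]; field_simp; ring
  have key : ∀ a b : ℝ, 0 ≤ a → 0 ≤ b → b ^ r + c * (a ^ (r - 1) * b) ≤ a ^ r + c * b ^ r := by
    intro a b ha hb
    have hy := Real.young_inequality_of_nonneg (Real.rpow_nonneg ha (r - 1)) hb hconj
    rw [← Real.rpow_mul ha, show (r - 1) * c = r by rw [hc]; field_simp] at hy
    have h2 := mul_le_mul_of_nonneg_left hy hconj.nonneg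
    have h3 : c * (a ^ r / c + b ^ r / r) = a ^ r + c / r * b ^ r := by
      have := hconj.ne_zero; field_simp
    have h4 : c * b ^ r = b ^ r + c / r * b ^ r := by nth_rewrite 1 [← hc1]; ring
    linarith
  have h := key S.toReal s.toReal ENNReal.toReal_nonneg ENNReal.toReal_nonneg
  have h' := ENNReal.ofReal_le_ofReal h
  have e : ∀ {x : ℝ≥0∞} {t : ℝ}, x ≠ ∞ → 0 ≤ t → ENNReal.ofReal (x.toReal ^ t) = x ^ t := by
    intro x t hx ht
    rw [← ENNReal.ofReal_rpow_of_nonneg ENNReal.toReal_nonneg ht, ENNReal.ofReal_toReal hx]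
  have hnn : ∀ (x : ℝ≥0∞) (t : ℝ), 0 ≤ x.toReal ^ t := fun x t =>
    Real.rpow_nonneg ENNReal.toReal_nonneg t
  have hc0 := hconj.nonneg
  rw [ENNReal.ofReal_add (hnn _ _) (mul_nonneg hc0 (mul_nonneg (hnn _ _) ENNReal.toReal_nonneg)),
    ENNReal.ofReal_add (hnn _ _) (mul_nonneg hc0 (hnn _ _)), ENNReal.ofReal_mul hc0,
    ENNReal.ofReal_mul hc0, ENNReal.ofReal_mul (hnn _ _), e hs (by linarith), e hS (by linarith),
    e hS (by linarith), ENNReal.ofReal_toReal hs] at h'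
  exact h'

/-- Absorption inequality: if `2 c h ≤ S`, the first term on the right is large enough; otherwise
the second one is. -/
theorem mul_rpow_sub_one_mul_le {r : ℝ} (hr : 1 < r) {c : ℝ≥0∞} (S h : ℝ≥0∞) :
    c * (S ^ (r - 1) * h) ≤ 2⁻¹ * S ^ r + c * (2 * c) ^ (r - 1) * h ^ r := by
  rcases le_total (2 * c * h) S with hle | hle
  · refine le_add_right ?_
    have h1 : c * h ≤ 2⁻¹ * S := by
      calc c * h = 2⁻¹ * (2 * c * h) := by
            rw [mul_assoc, ← mul_assoc 2⁻¹, ENNReal.inv_mul_cancel two_ne_zero ENNReal.ofNat_ne_top,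
              one_mul]
        _ ≤ _ := by gcongr
    calc c * (S ^ (r - 1) * h) = S ^ (r - 1) * (c * h) := by ring
      _ ≤ S ^ (r - 1) * (2⁻¹ * S) := by gcongr
      _ = 2⁻¹ * S ^ r := by rw [← rpow_sub_one_mul_self S hr.le]; ring
  · refine le_add_left ?_
    calc c * (S ^ (r - 1) * h) ≤ c * ((2 * c * h) ^ (r - 1) * h) := by
          gcongr
      _ = _ := by
          rw [ENNReal.mul_rpow_of_nonneg _ _ (by linarith), ← rpow_sub_one_mul_self h hr.le]; ring

variable {m : ℕ → ℕ}

/-- The running maximum `max_{a ≤ A} E[h | F_a]` of the conditional expectations of `h`. -/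
def maxAvg (h : VilenkinGroup m → ℝ≥0∞) (A : ℕ) (x : VilenkinGroup m) : ℝ≥0∞ :=
  partialSups (fun a => avg a h x) A

theorem avg_le_maxAvg (h : VilenkinGroup m → ℝ≥0∞) (A : ℕ) (x : VilenkinGroup m) :
    avg A h x ≤ maxAvg h A x :=
  le_partialSups (fun a => avg a h x) A

theorem maxAvg_mono (h : VilenkinGroup m → ℝ≥0∞) (x : VilenkinGroup m) :
    Monotone fun A => maxAvg h A x :=
  (partialSups fun a => avg a h x).monotone

theorem maxAvg_succ (h : VilenkinGroup m → ℝ≥0∞) (A : ℕ) (x : VilenkinGroup m) :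
    maxAvg h (A + 1) x = maxAvg h A x ⊔ avg (A + 1) h x :=
  partialSups_add_one _ _

theorem maxAvg_eq_of_mem (h : VilenkinGroup m → ℝ≥0∞) {A : ℕ} {x y : VilenkinGroup m}
    (hy : y ∈ interval m A x) : maxAvg h A y = maxAvg h A x := by
  induction A with
  | zero => simpa [maxAvg] using avg_eq_of_mem h hy
  | succ A ih =>
    rw [maxAvg_succ, maxAvg_succ, ih (interval_anti (Nat.le_succ A) x hy), avg_eq_of_mem h hy]

variable [hm : Fact (∀ k, 2 ≤ m k)]

theorem measurable_maxAvg (h : VilenkinGroup m → ℝ≥0∞) (A : ℕ) : Measurable (maxAvg h A) :=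
  measurable_of_dependsOn fun _ _ hy => maxAvg_eq_of_mem h hy

theorem avg_le_genPow_mul {A a : ℕ} (ha : a ≤ A) (h : VilenkinGroup m → ℝ≥0∞)
    (x : VilenkinGroup m) : avg a h x ≤ genPow m A * ∫⁻ y, h y ∂haar m := by
  unfold avg
  gcongr ?_ * ?_
  · exact_mod_cast genPow_mono hm.out ha
  · exact setLIntegral_le_lintegral _ _

theorem maxAvg_le_genPow_mul (A : ℕ) (h : VilenkinGroup m → ℝ≥0∞) (x : VilenkinGroup m) :
    maxAvg h A x ≤ genPow m A * ∫⁻ y, h y ∂haar m :=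
  partialSups_le _ _ _ fun _ ha => avg_le_genPow_mul ha h x

/-- The first half of Doob's inequality. By the averaging property the new value `E[h | F_{A + 1}]`
may be replaced by `h` when it is multiplied by a power of the running maximum; what has been added
on both sides in the step inequality is finite and cancels. -/
theorem lintegral_maxAvg_rpow_le_lintegral_mul {r : ℝ} (hr : 1 < r)
    {h : VilenkinGroup m → ℝ≥0∞} (hh : Measurable h) (hfin : ∫⁻ x, h x ∂haar m ≠ ∞) (A : ℕ) :
    ∫⁻ x, maxAvg h A x ^ r ∂haar m ≤
      ENNReal.ofReal (r / (r - 1)) * ∫⁻ x, maxAvg h A x ^ (r - 1) * h x ∂haar m := by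
  have hr0 : 0 < r - 1 := by linarith
  induction A with
  | zero =>
    have h1 : ∫⁻ x, maxAvg h 0 x ^ r ∂haar m = ∫⁻ x, maxAvg h 0 x ^ (r - 1) * h x ∂haar m := by
      rw [← lintegral_mul_avg (A := 0) hh fun x y hy => by rw [maxAvg_eq_of_mem h hy]]
      refine lintegral_congr fun x => ?_
      rw [← rpow_sub_one_mul_self _ hr.le]
      simp [maxAvg]
    rw [h1]
    refine le_mul_of_one_le_left' ?_
    rw [← ENNReal.ofReal_one]
    refine ENNReal.ofReal_le_ofReal ?_
    rw [one_le_div hr0]; linarith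
  | succ A ih =>
    set c := ENNReal.ofReal (r / (r - 1)) with hc
    have hconst : (genPow m A : ℝ≥0∞) * ∫⁻ y, h y ∂haar m ≠ ∞ :=
      ENNReal.mul_ne_top (ENNReal.natCast_ne_top _) hfin
    have hS : ∀ x, maxAvg h A x ≠ ∞ := fun x =>
      ne_top_of_le_ne_top hconst (maxAvg_le_genPow_mul A h x)
    have havg : ∀ x, avg (A + 1) h x ≠ ∞ := fun x => (avg_lt_top hfin x).ne
    have hmS : ∀ B, Measurable fun x => maxAvg h B x ^ (r - 1) := fun B =>
      (measurable_maxAvg h B).pow_const _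
    have hstep := lintegral_mono (μ := haar m) fun x => sup_rpow_add_le hr (hS x) (havg x)
    simp only [← maxAvg_succ] at hstep
    rw [lintegral_add_left ((measurable_maxAvg h _).pow_const _),
      lintegral_add_left ((measurable_maxAvg h _).pow_const _),
      lintegral_const_mul' _ _ ENNReal.ofReal_ne_top, lintegral_const_mul' _ _ ENNReal.ofReal_ne_top,
      lintegral_mul_avg hh fun x y hy => by
        rw [maxAvg_eq_of_mem h (interval_anti (Nat.le_succ A) x hy)],
      lintegral_mul_avg hh fun x y hy => by rw [maxAvg_eq_of_mem h hy]] at hstep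
    -- the term that cancels is finite, as the running maximum is bounded at each level
    have hX : c * ∫⁻ x, maxAvg h A x ^ (r - 1) * h x ∂haar m ≠ ∞ := by
      refine ENNReal.mul_ne_top ENNReal.ofReal_ne_top (ne_top_of_le_ne_top ?_
        (lintegral_mono fun x => mul_le_mul_left
          (ENNReal.rpow_le_rpow (maxAvg_le_genPow_mul A h x) hr0.le) (h x)))
      rw [lintegral_const_mul _ hh]
      exact ENNReal.mul_ne_top (ENNReal.rpow_ne_top_of_nonneg hr0.le hconst) hfin
    have h2 := hstep.trans (add_le_add_left ih _)
    rw [add_comm] at h2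
    exact ENNReal.le_of_add_le_add_left hX h2

/-- **Doob's maximal inequality** in `L_r`, `r > 1`, for conditional expectations of a nonnegative
function. -/
theorem exists_lintegral_iSup_maxAvg_rpow_le (m : ℕ → ℕ) [hm : Fact (∀ k, 2 ≤ m k)] {r : ℝ}
    (hr : 1 < r) : ∃ C : ℝ≥0, ∀ h : VilenkinGroup m → ℝ≥0∞, Measurable h →
      ∫⁻ x, (⨆ A, maxAvg h A x) ^ r ∂haar m ≤ C * ∫⁻ x, h x ^ r ∂haar m := by
  have hr0 : 0 < r - 1 := by linarith
  set c := ENNReal.ofReal (r / (r - 1)) with hc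
  have hcpos : c ≠ 0 := by
    rw [hc, ne_eq, ENNReal.ofReal_eq_zero, not_le]; positivity
  have h2c : 2 * c ≠ ∞ := ENNReal.mul_ne_top ENNReal.ofNat_ne_top ENNReal.ofReal_ne_top
  set D := 2 * (c * (2 * c) ^ (r - 1)) with hD
  have hDtop : D ≠ ∞ := ENNReal.mul_ne_top ENNReal.ofNat_ne_top
    (ENNReal.mul_ne_top ENNReal.ofReal_ne_top (ENNReal.rpow_ne_top_of_nonneg hr0.le h2c))
  have hD0 : D ≠ 0 := by
    refine mul_ne_zero two_ne_zero (mul_ne_zero hcpos ?_)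
    exact (ENNReal.rpow_pos (by positivity) h2c).ne'
  refine ⟨D.toNNReal, fun h hh => ?_⟩
  rw [ENNReal.coe_toNNReal hDtop]
  -- if the right-hand side is infinite, the claim needs only that the constant is positive
  rcases eq_or_ne (∫⁻ x, h x ^ r ∂haar m) ∞ with htop | hfr
  · rw [htop, ENNReal.mul_top hD0]; exact le_top
  have hfin : ∫⁻ x, h x ∂haar m ≠ ∞ := by
    refine ne_top_of_le_ne_top (b := ∫⁻ x, (1 + h x ^ r) ∂haar m) ?_ (lintegral_mono fun x => ?_)
    · rw [lintegral_add_left measurable_const]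
      simpa using hfr
    · rcases le_total (h x) 1 with h1 | h1
      · exact le_add_right h1
      · exact le_add_left (by
          simpa using ENNReal.rpow_le_rpow_of_exponent_le h1 hr.le)
  have hlevel : ∀ A, ∫⁻ x, maxAvg h A x ^ r ∂haar m ≤ D * ∫⁻ x, h x ^ r ∂haar m := by
    intro A
    set I := ∫⁻ x, maxAvg h A x ^ r ∂haar m with hI
    have hItop : I ≠ ∞ := by
      refine ne_top_of_le_ne_top ?_ (lintegral_mono fun x =>
        ENNReal.rpow_le_rpow (maxAvg_le_genPow_mul A h x) (by linarith : 0 ≤ r))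
      rw [lintegral_const, measure_univ, mul_one]
      exact ENNReal.rpow_ne_top_of_nonneg (by linarith)
        (ENNReal.mul_ne_top (ENNReal.natCast_ne_top _) hfin)
    have h1 := lintegral_maxAvg_rpow_le_lintegral_mul hr hh hfin A
    rw [← lintegral_const_mul' _ _ ENNReal.ofReal_ne_top] at h1
    have h2 := h1.trans (lintegral_mono fun x => mul_rpow_sub_one_mul_le hr (maxAvg h A x) (h x))
    rw [lintegral_add_left (((measurable_maxAvg h A).pow_const r).const_mul _),
      lintegral_const_mul' _ _ (by simp), lintegral_const_mul _ (hh.pow_const r), ← hI] at h2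
    have h3 : (2⁻¹ : ℝ≥0∞) * I + 2⁻¹ * I = I := by
      rw [← add_mul, ENNReal.inv_two_add_inv_two, one_mul]
    have h4 : (2⁻¹ : ℝ≥0∞) * I ≤ c * (2 * c) ^ (r - 1) * ∫⁻ x, h x ^ r ∂haar m := by
      refine ENNReal.le_of_add_le_add_left (a := 2⁻¹ * I) (ENNReal.mul_ne_top (by simp) hItop) ?_
      rw [h3]; exact h2
    calc I = 2 * (2⁻¹ * I) := by
          rw [← mul_assoc, ENNReal.mul_inv_cancel two_ne_zero ENNReal.ofNat_ne_top, one_mul]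
      _ ≤ 2 * (c * (2 * c) ^ (r - 1) * ∫⁻ x, h x ^ r ∂haar m) := by gcongr
      _ = _ := by rw [hD]; ring
  simp only [iSup_rpow _ (by linarith : 0 < r)]
  rw [lintegral_iSup (fun A => (measurable_maxAvg h A).pow_const r)
    fun A B hAB x => ENNReal.rpow_le_rpow (maxAvg_mono h x hAB) (by linarith)]
  exact iSup_le hlevel

end

/-! ### Maximal functions along translations -/

section

variable {m : ℕ → ℕ}

variable (m) in
/-- The ratio `M_s / M_A`. -/
def ratio (s A : ℕ) : ℝ≥0∞ := genPow m s / genPow m A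

theorem add_single_mem_interval {A s : ℕ} (h : A ≤ s) (x : VilenkinGroup m) (j : ZMod (m s)) :
    x + Pi.single s j ∈ interval m A x := by
  intro k hk
  have : k ≠ s := by omega
  simp [this]

/-- The maximal function of a sequence `G` along translations in single coordinates: a translation
in the coordinate `s ≤ A` of `G A` carries the weight `(M_s / M_A) ^ (1 / 2)`. -/
def shiftMax (G : ℕ → VilenkinGroup m → ℝ≥0∞) (x : VilenkinGroup m) : ℝ≥0∞ :=
  ⨆ (A : ℕ) (s : ℕ) (_ : s ≤ A) (j : ZMod (m s)),
    ratio m s A ^ (1 / 2 : ℝ) * G A (x + Pi.single s j)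

theorem le_shiftMax (G : ℕ → VilenkinGroup m → ℝ≥0∞) (x : VilenkinGroup m) {s A : ℕ} (h : s ≤ A)
    (j : ZMod (m s)) :
    ratio m s A ^ (1 / 2 : ℝ) * G A (x + Pi.single s j) ≤ shiftMax G x :=
  le_iSup_of_le A <| le_iSup_of_le s <| le_iSup_of_le h <| le_iSup_of_le j le_rfl

variable [hm : Fact (∀ k, 2 ≤ m k)]

theorem ratio_self (A : ℕ) : ratio m A A = 1 :=
  ENNReal.div_self (genPow_ne_zero A) (ENNReal.natCast_ne_top _)

theorem ratio_succ_le (s A : ℕ) : ratio m s (A + 1) ≤ 2⁻¹ * ratio m s A := by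
  rw [ratio, ratio, ENNReal.div_eq_inv_mul, ENNReal.div_eq_inv_mul, ← mul_assoc,
    ← ENNReal.mul_inv (Or.inl two_ne_zero) (Or.inl ENNReal.ofNat_ne_top)]
  gcongr
  exact_mod_cast two_mul_genPow_le hm.out A

theorem ratio_antitone (s : ℕ) : Antitone (ratio m s) :=
  antitone_nat_of_succ_le fun A => (ratio_succ_le s A).trans
    (mul_le_of_le_one_left' (ENNReal.inv_le_one.mpr one_le_two))

theorem ratio_le_pow {s A : ℕ} (h : s ≤ A) : ratio m s A ≤ 2⁻¹ ^ (A - s) := by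
  induction A, h using Nat.le_induction with
  | base => simp [ratio_self]
  | succ A hA ih =>
    rw [Nat.succ_sub hA, pow_succ']
    exact (ratio_succ_le s A).trans (by gcongr)

/-- The bound `∑_i 2 ^ (-γ i)` of the sums `∑_{s ≤ A} (M_s / M_A) ^ γ`. -/
def ratioSumBound (γ : ℝ) : ℝ≥0∞ := ∑' i : ℕ, ((2⁻¹ : ℝ≥0∞) ^ γ) ^ i

theorem ratioSumBound_ne_top {γ : ℝ} (hγ : 0 < γ) : ratioSumBound γ ≠ ∞ := by
  rw [ratioSumBound, ENNReal.tsum_geometric]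
  refine ENNReal.inv_ne_top.mpr (tsub_pos_of_lt ?_).ne'
  exact ENNReal.rpow_lt_one (ENNReal.inv_lt_one.mpr ENNReal.one_lt_two) hγ

theorem sum_ratio_rpow_le {γ : ℝ} (hγ : 0 < γ) (A : ℕ) :
    ∑ s ∈ Finset.range (A + 1), ratio m s A ^ γ ≤ ratioSumBound γ := by
  calc ∑ s ∈ Finset.range (A + 1), ratio m s A ^ γ
      ≤ ∑ s ∈ Finset.range (A + 1), ((2⁻¹ : ℝ≥0∞) ^ γ) ^ (A - s) := by
        refine Finset.sum_le_sum fun s hs => ?_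
        have hsA : s ≤ A := by have := Finset.mem_range.mp hs; omega
        rw [← ENNReal.rpow_natCast, ← ENNReal.rpow_mul, mul_comm, ENNReal.rpow_mul,
          ENNReal.rpow_natCast]
        exact ENNReal.rpow_le_rpow (ratio_le_pow hsA) hγ.le
    _ = ∑ i ∈ Finset.range (A + 1), ((2⁻¹ : ℝ≥0∞) ^ γ) ^ i := by
        rw [← Finset.sum_range_reflect]
        exact Finset.sum_congr rfl fun i hi => by
          congr 1; have := Finset.mem_range.mp hi; omega
    _ ≤ _ := ENNReal.sum_le_tsum _

/-- The translate of `Q_A` in the coordinate `s` is `Q_s` plus translated increments; the weight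
`(M_s / M_A) ^ c` may be moved onto the increments because it decreases in `A`. -/
theorem weighted_le_add_sum {Q : ℕ → VilenkinGroup m → ℝ≥0∞}
    (hQ : ∀ A x, ∀ y ∈ interval m A x, Q A y = Q A x) {c : ℝ} (hc : 0 ≤ c) {s A : ℕ}
    (h : s ≤ A) (x : VilenkinGroup m) (j : ZMod (m s)) :
    ratio m s A ^ c * Q A (x + Pi.single s j) ≤ Q s x + ∑ a ∈ Finset.Ico s A,
      ratio m s a ^ c * (Q (a + 1) (x + Pi.single s j) - Q a (x + Pi.single s j)) := by
  induction A, h using Nat.le_induction with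
  | base => simp [ratio_self, hQ s x _ (add_single_mem_interval le_rfl x j)]
  | succ A hA ih =>
    rw [Finset.sum_Ico_succ_top hA, ← add_assoc]
    set z := x + Pi.single s j
    calc ratio m s (A + 1) ^ c * Q (A + 1) z
        ≤ ratio m s A ^ c * (Q A z + (Q (A + 1) z - Q A z)) :=
          mul_le_mul' (ENNReal.rpow_le_rpow (ratio_antitone s (Nat.le_succ A)) hc)
            le_add_tsub
      _ ≤ _ := by rw [mul_add]; gcongr

theorem le_sum_sum {I : Finset ℕ} (u : ∀ s : ℕ, ZMod (m s) → ℝ≥0∞) {s : ℕ} (hs : s ∈ I)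
    (j : ZMod (m s)) : u s j ≤ ∑ s ∈ I, ∑ j : ZMod (m s), u s j :=
  (Finset.single_le_sum (f := u s) (fun _ _ => zero_le) (Finset.mem_univ j)).trans
    (Finset.single_le_sum (f := fun s => ∑ j : ZMod (m s), u s j) (fun _ _ => zero_le) hs)

theorem sum_Ico_le_tsum (c : ℝ) (D : ℕ → VilenkinGroup m → ℝ≥0∞) {s A : ℕ}
    (x : VilenkinGroup m) (j : ZMod (m s)) :
    ∑ a ∈ Finset.Ico s A, ratio m s a ^ c * D a (x + Pi.single s j) ≤
      ∑' a, ∑ s ∈ Finset.range (a + 1), ∑ j : ZMod (m s),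
        ratio m s a ^ c * D a (x + Pi.single s j) := by
  refine (Finset.sum_le_sum fun a ha => ?_).trans (ENNReal.sum_le_tsum (Finset.Ico s A))
  have hsa : s ∈ Finset.range (a + 1) :=
    Finset.mem_range.mpr (Nat.lt_succ_of_le (Finset.mem_Ico.mp ha).1)
  exact le_sum_sum (fun s (j : ZMod (m s)) => ratio m s a ^ c * D a (x + Pi.single s j)) hsa j

/-- The `L_p`-bound of `shiftMax G` for an adapted increasing sequence `G`. With `Q_A = G_A ^ p`,
the translation in the coordinate `s` does not change `Q_s`, so that only the increments
`Q_{a + 1} - Q_a` with `a ≥ s` are moved. Their translates have the same integral, and the weights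
`(M_s / M_a) ^ (p / 2)` are summable over `s ≤ a`. -/
theorem lintegral_shiftMax_rpow_le {b : ℕ} (hb : ∀ k, m k ≤ b) {p : ℝ} (hp : 0 < p)
    {G : ℕ → VilenkinGroup m → ℝ≥0∞} (hG : ∀ A x, ∀ y ∈ interval m A x, G A y = G A x)
    (hmono : ∀ x, Monotone fun A => G A x) :
    ∫⁻ x, shiftMax G x ^ p ∂haar m ≤
      (1 + b * ratioSumBound (1 / 2 * p)) * ∫⁻ x, (⨆ A, G A x) ^ p ∂haar m := by
  set c := 1 / 2 * p with hc
  have hc0 : 0 < c := by positivity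
  set Q : ℕ → VilenkinGroup m → ℝ≥0∞ := fun A x => G A x ^ p with hQdef
  have hQ : ∀ A x, ∀ y ∈ interval m A x, Q A y = Q A x := fun A x y hy => by
    simp only [hQdef, hG A x y hy]
  have hQm : ∀ A, Measurable (Q A) := fun A => measurable_of_dependsOn (hQ A)
  have hQmono : ∀ x, Monotone fun A => Q A x := fun x A B hAB =>
    ENNReal.rpow_le_rpow (hmono x hAB) hp.le
  set D : ℕ → VilenkinGroup m → ℝ≥0∞ := fun a x => Q (a + 1) x - Q a x with hDdef
  have hDm : ∀ a, Measurable (D a) := fun a => (hQm _).sub (hQm _)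
  have hshift : ∀ (s a : ℕ) (j : ZMod (m s)),
      Measurable fun x : VilenkinGroup m => D a (x + Pi.single s j) :=
    fun s a j => (hDm a).comp (measurePreserving_add_right (Pi.single s j)).measurable
  have hpt : ∀ x, shiftMax G x ^ p ≤ (⨆ A, Q A x) + ∑' a, ∑ s ∈ Finset.range (a + 1),
      ∑ j : ZMod (m s), ratio m s a ^ c * D a (x + Pi.single s j) := by
    intro x
    simp only [shiftMax, iSup_rpow _ hp]
    refine iSup_le fun A => iSup_le fun s => iSup_le fun hs => iSup_le fun j => ?_
    rw [ENNReal.mul_rpow_of_nonneg _ _ hp.le, ← ENNReal.rpow_mul]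
    exact (weighted_le_add_sum hQ hc0.le hs x j).trans
      (add_le_add (le_iSup (fun A => Q A x) s) (sum_Ico_le_tsum c D x j))
  have hterm : ∀ (s a : ℕ) (j : ZMod (m s)),
      Measurable fun x : VilenkinGroup m => ratio m s a ^ c * D a (x + Pi.single s j) :=
    fun s a j => (hshift s a j).const_mul _
  have hsum1 : ∀ a s : ℕ, Measurable fun x : VilenkinGroup m => ∑ j : ZMod (m s),
      ratio m s a ^ c * D a (x + Pi.single s j) :=
    fun a s => Finset.measurable_sum _ fun j _ => hterm s a j
  have hsum2 : ∀ a : ℕ, Measurable fun x : VilenkinGroup m => ∑ s ∈ Finset.range (a + 1), ∑ j : ZMod (m s),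
      ratio m s a ^ c * D a (x + Pi.single s j) :=
    fun a => Finset.measurable_sum _ fun s _ => hsum1 a s
  have hlevel : ∀ a, ∫⁻ x, ∑ s ∈ Finset.range (a + 1), ∑ j : ZMod (m s),
      ratio m s a ^ c * D a (x + Pi.single s j) ∂haar m ≤
        b * ratioSumBound c * ∫⁻ x, D a x ∂haar m := by
    intro a
    rw [lintegral_finsetSum _ fun s _ => hsum1 a s]
    calc _ ≤ ∑ s ∈ Finset.range (a + 1), (b : ℝ≥0∞) * (ratio m s a ^ c * ∫⁻ x, D a x ∂haar m) := by
          refine Finset.sum_le_sum fun s _ => ?_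
          rw [lintegral_finsetSum _ fun j _ => hterm s a j]
          have : ∀ j : ZMod (m s), ∫⁻ x, ratio m s a ^ c * D a (x + Pi.single s j) ∂haar m =
              ratio m s a ^ c * ∫⁻ x, D a x ∂haar m := fun j => by
            rw [lintegral_const_mul _ (hshift s a j), lintegral_add_right _ (hDm a)]
          simp only [this, Finset.sum_const, Finset.card_univ, ZMod.card, nsmul_eq_mul]
          gcongr
          exact_mod_cast hb s
      _ = b * (∑ s ∈ Finset.range (a + 1), ratio m s a ^ c) * ∫⁻ x, D a x ∂haar m := by
          rw [← Finset.mul_sum, ← Finset.sum_mul, mul_assoc]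
      _ ≤ _ := by
          gcongr
          exact sum_ratio_rpow_le hc0 a
  have hD : ∑' a, ∫⁻ x, D a x ∂haar m ≤ ∫⁻ x, ⨆ A, Q A x ∂haar m := by
    rw [← lintegral_tsum fun a => (hDm a).aemeasurable]
    refine lintegral_mono fun x => ENNReal.tsum_le_of_sum_range_le fun n => ?_
    refine le_trans ?_ (le_iSup (fun A => Q A x) n)
    -- truncated subtraction is harmless since `Q` increases
    have : ∑ a ∈ Finset.range n, D a x + Q 0 x = Q n x := by
      induction n with
      | zero => simp
      | succ n ih =>
        rw [Finset.sum_range_succ, add_right_comm, ih, add_comm]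
        exact tsub_add_cancel_of_le (hQmono x (Nat.le_succ n))
    rw [← this]
    exact le_add_right le_rfl
  calc ∫⁻ x, shiftMax G x ^ p ∂haar m ≤ _ := lintegral_mono hpt
    _ = ∫⁻ x, ⨆ A, Q A x ∂haar m + ∑' a, ∫⁻ x, ∑ s ∈ Finset.range (a + 1),
          ∑ j : ZMod (m s), ratio m s a ^ c * D a (x + Pi.single s j) ∂haar m := by
        rw [lintegral_add_left (Measurable.iSup hQm),
          lintegral_tsum fun a => (hsum2 a).aemeasurable]
    _ ≤ ∫⁻ x, ⨆ A, Q A x ∂haar m +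
          b * ratioSumBound c * ∫⁻ x, ⨆ A, Q A x ∂haar m := by
        gcongr
        refine (ENNReal.tsum_le_tsum hlevel).trans ?_
        rw [ENNReal.tsum_mul_left]
        gcongr
    _ = _ := by
        simp only [iSup_rpow _ hp, hQdef]
        ring

end

/-! ### Pointwise bound of the maximal operator -/

section

variable {m : ℕ → ℕ}

theorem measurable_maximalFunction {f : ℕ → VilenkinGroup m → ℂ}
    (hf : Martingale f (filtration m) (haar m)) : Measurable (maximalFunction m f) :=
  Measurable.iSup fun n => ((hf.stronglyMeasurable n).mono ((filtration m).le _)).measurable.enorm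

variable [hm : Fact (∀ k, 2 ≤ m k)]

/-- A reverse Hölder inequality with loss: for functions of the first `N` coordinates and `q ≤ 1`,
the mean over an interval of level `A` is at most `(M_N / M_A) ^ (1 / q - 1)` times the `L_q`-mean,
because a single value is controlled by the `L_q`-mean. -/
theorem avg_le_rpow_avg_rpow {q : ℝ} (hq0 : 0 < q) (hq1 : q ≤ 1) {A N : ℕ} (hAN : A ≤ N)
    {g : VilenkinGroup m → ℝ≥0∞} (hg : ∀ x, ∀ y ∈ interval m N x, g y = g x)
    (x : VilenkinGroup m) :
    avg A g x ≤ ratio m N A ^ (1 / q - 1) * avg A (fun y => g y ^ q) x ^ (1 / q) := by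
  have hq : 1 ≤ 1 / q := by rw [one_le_div hq0]; exact hq1
  have hgq : ∀ x, ∀ y ∈ interval m N x, g y ^ q = g x ^ q := fun x y hy => by rw [hg x y hy]
  set a := avg A (fun y => g y ^ q) x with ha
  have hval : ∀ y ∈ interval m A x, g y ^ q ≤ ratio m N A * a := by
    intro y hy
    rw [← avg_of_dependsOn hgq y, ha, avg, avg, ratio, ← mul_assoc,
      ENNReal.div_mul_cancel (genPow_ne_zero A) (ENNReal.natCast_ne_top _)]
    refine mul_le_mul_right (lintegral_mono_set ?_) _
    rw [← interval_eq_of_mem hy]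
    exact interval_anti hAN y
  calc avg A g x
      ≤ genPow m A * ∫⁻ y in interval m A x, (ratio m N A * a) ^ (1 / q - 1) * g y ^ q ∂haar m := by
        rw [avg]
        refine mul_le_mul_right (setLIntegral_mono
          ((measurable_of_dependsOn hgq).const_mul _) fun y hy => ?_) _
        calc g y = (g y ^ q) ^ (1 / q - 1) * g y ^ q := by
              rw [rpow_sub_one_mul_self _ hq, ← ENNReal.rpow_mul, mul_one_div_cancel hq0.ne',
                ENNReal.rpow_one]
          _ ≤ _ := by
              exact mul_le_mul_left (ENNReal.rpow_le_rpow (hval y hy) (by linarith)) _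
    _ = ratio m N A ^ (1 / q - 1) * a ^ (1 / q) := by
        rw [lintegral_const_mul _ (measurable_of_dependsOn hgq), mul_left_comm, ← avg, ← ha,
          ENNReal.mul_rpow_of_nonneg _ _ (by linarith), mul_assoc, rpow_sub_one_mul_self _ hq]

/-- The pointwise bound of the maximal operator. For `M_N ≤ n < M_{N + 1}` the sum of the first `n`
partial sums is at most a constant times the sum over `s ≤ A ≤ N` and `j` of
`M_s (M_N / M_A) ^ (1 / q - 1) G_A(x + j e_s)`. Half of the factor `M_s / M_A` goes into `shiftMax`,
the other half makes the sum over `s` converge, and the remaining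
`M_A (M_N / M_A) ^ (1 / q - 1) = M_N (M_A / M_N) ^ (2 - 1 / q)` is summable over `A`. -/
theorem rieszMaximal_le_shiftMax {b : ℕ} (hb : ∀ k, m k ≤ b) {q : ℝ} (hq : 1 / 2 < q)
    (hq1 : q < 1) {f : ℕ → VilenkinGroup m → ℂ} (hf : Martingale f (filtration m) (haar m))
    (x : VilenkinGroup m) :
    rieszMaximal m f x ≤
      ((2 * b ^ 2 + b : ℕ) : ℝ≥0∞) * (b * b * ratioSumBound (1 / 2) * ratioSumBound (2 - 1 / q)) *
        shiftMax (fun A y => maxAvg (fun z => maximalFunction m f z ^ q) A y ^ (1 / q)) x := by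
  have hq0 : 0 < q := by linarith
  have hβ0 : 0 < 1 / q - 1 := by rw [sub_pos, one_lt_div hq0]; exact hq1
  have hβ1 : 0 < 2 - 1 / q := by rw [sub_pos, div_lt_iff₀ hq0]; linarith
  set h : VilenkinGroup m → ℝ≥0∞ := fun z => maximalFunction m f z ^ q with hh
  set G : ℕ → VilenkinGroup m → ℝ≥0∞ := fun A y => maxAvg h A y ^ (1 / q) with hG
  set K : ℝ≥0∞ := ((2 * b ^ 2 + b : ℕ) : ℝ≥0∞) *
    (b * b * ratioSumBound (1 / 2) * ratioSumBound (2 - 1 / q)) with hK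
  have hb1 : 1 ≤ b := by have := hm.out 0; have := hb 0; omega
  have hKtop : K ≠ ∞ := by
    refine ENNReal.mul_ne_top (ENNReal.natCast_ne_top _) (ENNReal.mul_ne_top (ENNReal.mul_ne_top
      (ENNReal.mul_ne_top (ENNReal.natCast_ne_top _) (ENNReal.natCast_ne_top _)) ?_) ?_)
    · exact ratioSumBound_ne_top (by norm_num)
    · exact ratioSumBound_ne_top hβ1
  have hKpos : K ≠ 0 := by
    have h1 : ∀ γ, ratioSumBound γ ≠ 0 := fun γ => by
      refine (lt_of_lt_of_le one_pos ?_).ne'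
      exact (pow_zero _).symm.trans_le
        (ENNReal.le_tsum (f := fun i : ℕ => ((2⁻¹ : ℝ≥0∞) ^ γ) ^ i) 0)
    have h2 : (b : ℝ≥0∞) ≠ 0 := by exact_mod_cast (by omega : b ≠ 0)
    have h3 : ((2 * b ^ 2 + b : ℕ) : ℝ≥0∞) ≠ 0 := by
      exact_mod_cast (by positivity : 2 * b ^ 2 + b ≠ 0)
    exact mul_ne_zero h3 (mul_ne_zero (mul_ne_zero (mul_ne_zero h2 h2) (h1 _)) (h1 _))
  set Z := shiftMax G x with hZ
  rcases eq_or_ne Z ∞ with hZtop | hZtop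
  · rw [hZtop, ENNReal.mul_top hKpos]; exact le_top
  -- `M_{N + 1} / M_A ≤ b M_N / M_A`, and `b ^ (1 / q - 1) ≤ b` as `q > 1 / 2`
  have havg : ∀ {A N : ℕ}, A ≤ N → ∀ y, avg A (fun z => ‖f (N + 1) z‖ₑ) y ≤
      b * (ratio m N A ^ (1 / q - 1) * G A y) := by
    intro A N hAN y
    have hdep : ∀ u, ∀ v ∈ interval m (N + 1) u, ‖f (N + 1) v‖ₑ = ‖f (N + 1) u‖ₑ := fun u v hv => by
      rw [eq_of_measurable_intervalAlgebra (hf.stronglyMeasurable (N + 1)).measurable hv]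
    refine (avg_le_rpow_avg_rpow hq0 hq1.le (hAN.trans (Nat.le_succ N)) hdep y).trans ?_
    rw [← mul_assoc]
    gcongr ?_ * ?_
    · have h1 : ratio m (N + 1) A ≤ b * ratio m N A := by
        rw [ratio, ratio, ← mul_div_assoc, genPow, Nat.cast_mul]
        gcongr
        exact hb N
      refine (ENNReal.rpow_le_rpow h1 hβ0.le).trans ?_
      rw [ENNReal.mul_rpow_of_nonneg _ _ hβ0.le]
      gcongr
      calc (b : ℝ≥0∞) ^ (1 / q - 1) ≤ (b : ℝ≥0∞) ^ (1 : ℝ) :=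
            ENNReal.rpow_le_rpow_of_exponent_le (by exact_mod_cast hb1) (by linarith)
        _ = b := ENNReal.rpow_one _
    · refine ENNReal.rpow_le_rpow ((avg_mono A (fun z => ?_) y).trans (avg_le_maxAvg h A y))
        (by positivity)
      exact ENNReal.rpow_le_rpow (le_iSup (fun n => ‖f n z‖ₑ) (N + 1)) hq0.le
  have hM : ∀ {s A : ℕ}, (genPow m s : ℝ≥0∞) = genPow m A * ratio m s A := fun {s A} => by
    rw [ratio, ENNReal.mul_div_cancel (genPow_ne_zero A) (ENNReal.natCast_ne_top _)]
  have hsum : ∀ n, ‖∑ k ∈ Finset.range n, partialSum m f (k + 1) x‖ₑ ≤ n * (K * Z) := by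
    intro n
    rcases Nat.eq_zero_or_pos n with rfl | hn
    · simp
    obtain ⟨N, hN1, hN2⟩ := exists_genPow_le_lt hm.out hn
    have hinner : ∀ A ∈ Finset.range (N + 1), ∀ s ∈ Finset.range (A + 1), ∀ j : ZMod (m s),
        genPow m s * avg A (fun y => ‖f (N + 1) y‖ₑ) (x + Pi.single s j) ≤
          genPow m N * b * ratio m A N ^ (2 - 1 / q) * Z * ratio m s A ^ (1 / 2 : ℝ) := by
      intro A hA s hs j
      have hAN : A ≤ N := by have := Finset.mem_range.mp hA; omega
      have hsA : s ≤ A := by have := Finset.mem_range.mp hs; omega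
      have e1 : ratio m s A = ratio m s A ^ (1 / 2 : ℝ) * ratio m s A ^ (1 / 2 : ℝ) := by
        rw [← ENNReal.rpow_add_of_nonneg _ _ (by norm_num) (by norm_num)]
        norm_num
      have e2 : ratio m A N * ratio m N A ^ (1 / q - 1) = ratio m A N ^ (2 - 1 / q) := by
        have hinv : ratio m N A = (ratio m A N)⁻¹ := by
          rw [ratio, ratio, ENNReal.inv_div (Or.inl (ENNReal.natCast_ne_top _))
            (Or.inl (genPow_ne_zero _))]
        have h0 : ratio m A N ≠ 0 :=
          (ENNReal.div_pos (genPow_ne_zero _) (ENNReal.natCast_ne_top _)).ne'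
        have h1 : ratio m A N ≠ ∞ := ENNReal.div_ne_top (ENNReal.natCast_ne_top _) (genPow_ne_zero _)
        rw [hinv, ENNReal.inv_rpow, ← ENNReal.rpow_neg]
        nth_rewrite 1 [← ENNReal.rpow_one (ratio m A N)]
        rw [← ENNReal.rpow_add _ _ h0 h1]
        congr 1; ring
      calc genPow m s * avg A (fun y => ‖f (N + 1) y‖ₑ) (x + Pi.single s j)
          ≤ genPow m s * (b * (ratio m N A ^ (1 / q - 1) * G A (x + Pi.single s j))) := by
            gcongr; exact havg hAN _
        _ = genPow m N * ratio m A N * (ratio m s A ^ (1 / 2 : ℝ) * ratio m s A ^ (1 / 2 : ℝ)) *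
              (b * (ratio m N A ^ (1 / q - 1) * G A (x + Pi.single s j))) := by
            rw [← e1, ← hM, ← hM]
        _ = genPow m N * b * (ratio m A N * ratio m N A ^ (1 / q - 1)) *
              (ratio m s A ^ (1 / 2 : ℝ) * G A (x + Pi.single s j)) *
                ratio m s A ^ (1 / 2 : ℝ) := by ring
        _ ≤ _ := by
            rw [e2]
            gcongr
            exact le_shiftMax G x hsA j
    calc _ ≤ _ := enorm_sum_partialSum_le hb hf hN2 x
      _ ≤ ((2 * b ^ 2 + b : ℕ) : ℝ≥0∞) * ∑ A ∈ Finset.range (N + 1),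
            genPow m N * b * b * Z * ratioSumBound (1 / 2) * ratio m A N ^ (2 - 1 / q) := by
          gcongr with A hA
          calc _ ≤ ∑ s ∈ Finset.range (A + 1), ∑ _j : ZMod (m s), genPow m N * b *
                  ratio m A N ^ (2 - 1 / q) * Z * ratio m s A ^ (1 / 2 : ℝ) :=
                Finset.sum_le_sum fun s hs => Finset.sum_le_sum fun j _ => hinner A hA s hs j
            _ ≤ ∑ s ∈ Finset.range (A + 1), b * (genPow m N * b *
                  ratio m A N ^ (2 - 1 / q) * Z * ratio m s A ^ (1 / 2 : ℝ)) := by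
                refine Finset.sum_le_sum fun s _ => ?_
                rw [Finset.sum_const, Finset.card_univ, ZMod.card, nsmul_eq_mul]
                gcongr
                exact hb s
            _ = genPow m N * b * b * Z * (∑ s ∈ Finset.range (A + 1), ratio m s A ^ (1 / 2 : ℝ)) *
                  ratio m A N ^ (2 - 1 / q) := by
                rw [← Finset.mul_sum, ← Finset.mul_sum]; ring
            _ ≤ _ := by
                gcongr
                exact sum_ratio_rpow_le (by norm_num) A
      _ ≤ ((2 * b ^ 2 + b : ℕ) : ℝ≥0∞) * (genPow m N * b * b * Z * ratioSumBound (1 / 2) *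
            ratioSumBound (2 - 1 / q)) := by
          rw [← Finset.mul_sum]
          gcongr
          exact sum_ratio_rpow_le hβ1 N
      _ = genPow m N * (K * Z) := by rw [hK]; ring
      _ ≤ n * (K * Z) := by gcongr
  have hV : K * Z ≠ ∞ := ENNReal.mul_ne_top hKtop hZtop
  refine iSup_le fun n => ?_
  rw [← ENNReal.ofReal_toReal hV, ← ofReal_norm]
  refine ENNReal.ofReal_le_ofReal (norm_rieszMean_le ENNReal.toReal_nonneg (fun n => ?_) n)
  have := ENNReal.toReal_mono (ENNReal.mul_ne_top (ENNReal.natCast_ne_top _) hV) (hsum n)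
  rwa [toReal_enorm, ENNReal.toReal_mul, ENNReal.toReal_natCast] at this

end

end Vilenkin

end

theorem theorem1 (m : ℕ → ℕ) (hm : ∀ k, 2 ≤ m k) (hbdd : BddAbove (Set.range m))
    (p : ℝ) (hp : 1 / 2 < p) :
    ∃ C : ℝ≥0, ∀ f : ℕ → Vilenkin.VilenkinGroup m → ℂ, Vilenkin.MemHp m p f →
      Vilenkin.normLp m p (Vilenkin.rieszMaximal m f) ≤ C * Vilenkin.normHp m p f := by
  open Vilenkin in
  have : Fact (∀ k, 2 ≤ m k) := ⟨hm⟩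
  obtain ⟨b, hb'⟩ := hbdd
  have hb : ∀ k, m k ≤ b := fun k => hb' ⟨k, rfl⟩
  have hp0 : 0 < p := by linarith
  obtain ⟨q, hq, hqm⟩ := exists_between (show (1 / 2 : ℝ) < min p 1 by
    rw [lt_min_iff]; exact ⟨hp, by norm_num⟩)
  have hqp : q < p := hqm.trans_le (min_le_left _ _)
  have hq1 : q < 1 := hqm.trans_le (min_le_right _ _)
  have hq0 : 0 < q := by linarith
  obtain ⟨C₃, hC₃⟩ := exists_lintegral_iSup_maxAvg_rpow_le m
    (show 1 < p / q by rw [one_lt_div hq0]; exact hqp)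
  set C₁ : ℝ≥0∞ := ((2 * b ^ 2 + b : ℕ) : ℝ≥0∞) *
    (b * b * ratioSumBound (1 / 2) * ratioSumBound (2 - 1 / q)) with hC₁
  set C₂ : ℝ≥0∞ := 1 + b * ratioSumBound (1 / 2 * p) with hC₂
  have hC₁top : C₁ ≠ ∞ := by
    have hβ1 : 0 < 2 - 1 / q := by rw [sub_pos, div_lt_iff₀ hq0]; linarith
    exact ENNReal.mul_ne_top (ENNReal.natCast_ne_top _) (ENNReal.mul_ne_top (ENNReal.mul_ne_top
      (ENNReal.mul_ne_top (ENNReal.natCast_ne_top _) (ENNReal.natCast_ne_top _))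
      (ratioSumBound_ne_top (by norm_num))) (ratioSumBound_ne_top hβ1))
  have hC₂top : C₂ ≠ ∞ := ENNReal.add_ne_top.mpr ⟨ENNReal.one_ne_top,
    ENNReal.mul_ne_top (ENNReal.natCast_ne_top _) (ratioSumBound_ne_top (by positivity))⟩
  set C : ℝ≥0∞ := C₁ ^ p * (C₂ * C₃) with hC
  have hCtop : C ≠ ∞ := ENNReal.mul_ne_top (ENNReal.rpow_ne_top_of_nonneg hp0.le hC₁top)
    (ENNReal.mul_ne_top hC₂top ENNReal.coe_ne_top)
  refine ⟨(C ^ (1 / p)).toNNReal, fun f hf => ?_⟩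
  have hint : ∫⁻ x, rieszMaximal m f x ^ p ∂haar m ≤
      C * ∫⁻ x, maximalFunction m f x ^ p ∂haar m := by
    set h : VilenkinGroup m → ℝ≥0∞ := fun z => maximalFunction m f z ^ q with hh
    set G : ℕ → VilenkinGroup m → ℝ≥0∞ := fun A y => maxAvg h A y ^ (1 / q) with hG
    have hpow : ∀ y : ℝ≥0∞, (y ^ (1 / q)) ^ p = y ^ (p / q) := fun y => by
      rw [← ENNReal.rpow_mul]; congr 1; ring
    calc ∫⁻ x, rieszMaximal m f x ^ p ∂haar m
        ≤ ∫⁻ x, C₁ ^ p * shiftMax G x ^ p ∂haar m := by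
          refine lintegral_mono fun x => ?_
          rw [← ENNReal.mul_rpow_of_nonneg _ _ hp0.le]
          exact ENNReal.rpow_le_rpow (rieszMaximal_le_shiftMax hb hq hq1 hf.1 x) hp0.le
      _ = C₁ ^ p * ∫⁻ x, shiftMax G x ^ p ∂haar m :=
          lintegral_const_mul' _ _ (ENNReal.rpow_ne_top_of_nonneg hp0.le hC₁top)
      _ ≤ C₁ ^ p * (C₂ * ∫⁻ x, (⨆ A, G A x) ^ p ∂haar m) := by
          gcongr
          refine lintegral_shiftMax_rpow_le hb hp0 (fun A x y hy => ?_) fun x A B hAB => ?_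
          · simp only [hG, maxAvg_eq_of_mem h hy]
          · exact ENNReal.rpow_le_rpow (maxAvg_mono h x hAB) (by positivity)
      _ = C₁ ^ p * (C₂ * ∫⁻ x, (⨆ A, maxAvg h A x) ^ (p / q) ∂haar m) := by
          simp only [hG, ← iSup_rpow _ (show 0 < 1 / q by positivity), hpow]
      _ ≤ C₁ ^ p * (C₂ * (C₃ * ∫⁻ x, h x ^ (p / q) ∂haar m)) := by
          gcongr
          exact hC₃ h ((measurable_maximalFunction hf.1).pow_const q)
      _ = C * ∫⁻ x, maximalFunction m f x ^ p ∂haar m := by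
          have : ∀ x, h x ^ (p / q) = maximalFunction m f x ^ p := fun x => by
            rw [hh, ← ENNReal.rpow_mul, mul_div_cancel₀ _ hq0.ne']
          simp only [this, hC]
          ring
  rw [ENNReal.coe_toNNReal (ENNReal.rpow_ne_top_of_nonneg (by positivity) hCtop), normHp, normLp,
    normLp, ← ENNReal.mul_rpow_of_nonneg _ _ (by positivity)]
  exact ENNReal.rpow_le_rpow hint (by positivity)
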